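/- Let $\mathbb D=\{z\in\mathbb C:|z|<1\}$ and let $m$ be normalized Lebesgue measure on $\partial\mathbb D$. An inner function is an analytic map $g:\mathbb D\to\mathbb D$ whose radial limit $g(\xi)=\lim_{r\to1^-}g(r\xi)$ exists and has modulus one at $m$-almost every $\xi\in\partial\mathbb D$. Let $f$ be an inner function with $f(0)=0$ which is not a rotation (that is, not of the form $z\mapsto cz$ with $|c|=1$), and let $f^n$ be its $n$-th iterate, $n\ge1$. Then each $f^n$ is again an inner function, so that $f^n(\xi)=\lim_{r\to1^-}f^n(r\xi)$ is defined for almost every $\xi\in\partial\mathbb D$, and there is a constant $C=C(f)>0$ such that for every positive integer $N$, all complex numbers $a_1,\dots,a_N$ and every $z\in\mathbb D$, the integrand below is $m$-integrable and $$\int_{\partial\mathbb D}\Bigl|\sum_{n=1}^{N}a_n\bigl(f^n(\xi)-f^n(z)\bigr)\Bigr|^2P(z,\xi)\,dm(\xi)\;\le\;C\sum_{n=1}^{N}|a_n|^2\bigl(1-|f^n(z)|^2\bigr),$$ where $P(z,\xi)=(1-|z|^2)\,|\xi-z|^{-2}$ is the Poisson kernel. -/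

import Mathlib

open Filter Topology MeasureTheory Set

/-- `g` has radial limit `η` at the point `ξ` of the unit circle: `g (r ξ) → η` as `r → 1⁻`. -/
def HasRadialLimit (g : ℂ → ℂ) (ξ η : ℂ) : Prop :=
  Tendsto (fun r : ℝ => g ((r : ℂ) * ξ)) (𝓝[<] (1 : ℝ)) (𝓝 η)

/-- The boundary function `ξ ↦ g(ξ) = lim_{r → 1⁻} g (r ξ)` of a function `g` on the unit disc.
It is meaningful at those `ξ` where the radial limit exists. -/
noncomputable def radialLimit (g : ℂ → ℂ) (ξ : ℂ) : ℂ :=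
  limUnder (𝓝[<] (1 : ℝ)) (fun r : ℝ => g ((r : ℂ) * ξ))

/-- Inner functions: analytic maps of the open unit disc into itself whose radial limits exist
and have modulus one at almost every point of the unit circle. Only the values of `g` in the open
unit disc matter. The circle is parametrised by `θ ↦ circleMap 0 1 θ = exp (i θ)`. -/
structure IsInnerFunction (g : ℂ → ℂ) : Prop where
  differentiableOn : DifferentiableOn ℂ g (Metric.ball 0 1)
  mapsTo : MapsTo g (Metric.ball 0 1) (Metric.ball 0 1)
  ae_radialLimit : ∀ᵐ θ : ℝ, ∃ η : ℂ, ‖η‖ = 1 ∧ HasRadialLimit g (circleMap 0 1 θ) η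

/-- `g` is, on the open unit disc, a rotation `z ↦ c z` with `|c| = 1`. -/
def IsDiscRotation (g : ℂ → ℂ) : Prop :=
  ∃ c : ℂ, ‖c‖ = 1 ∧ EqOn g (fun z => c * z) (Metric.ball 0 1)

/-- The integrand `ξ ↦ |∑_{n=1}^N a_n (f^n(ξ) - f^n(z))|² P(z, ξ)`, where `f^n = f^[n]` is the
`n`-th iterate of `f` on the disc, `f^n(ξ)` is its radial limit at `ξ`, and
`P(z, ξ) = (1 - |z|²) / |ξ - z|²` for `|ξ| = 1` is the Poisson kernel of the unit disc. -/
noncomputable def oscillationIntegrand (f : ℂ → ℂ) (N : ℕ) (a : ℕ → ℂ) (z ξ : ℂ) : ℝ :=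
  ‖∑ n ∈ Finset.Icc 1 N, a n * (radialLimit (f^[n]) ξ - f^[n] z)‖ ^ 2 * poissonKernel 0 z ξ

/-! Let `u n` be the boundary function of `f^[n]` minus `f^[n] z`, in L² of harmonic measure at `z`.
The claim is that the `u n` are almost orthogonal, with covariances decaying geometrically in `|n -
k|`; a Schur test then gives the bound.

Write `f^[j + k] = f^[k] * (Q ∘ f^[k])` with `Q w = f^[j] w / w`, analytic because `f 0 = 0`. Since
`f^[k]` is unimodular on the circle, multiplying by its conjugate cancels that factor, and the
Poisson formula gives the exact covariance `Q w * (1 - |w|²)` at `w = f^[k] z`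
(`integral_iterate_sub_mul_conj`). As `f` is not a rotation, `f w / w` maps the disc into itself,
and Schwarz–Pick applied along the orbit yields `|Q w|² (1 - |w|²) ≤ c^(2j) (1 - |f^[j] w|²)` with
`c² = (1 + |f'(0)|) / 2 < 1` (`norm_iterateQuotient_sq_mul_le`).

Two classical facts are needed. Fatou's theorem: a bounded analytic function has a Lipschitz
primitive, almost everywhere differentiable along the circle, and a kernel estimate turns this into
radial convergence of the derivative. Iterates are inner: on the circle, composing with an inner `g`
fixing `0` preserves orthogonality of powers, so the mean square of `f ∘ g` is at least that of
every dilation of `f`, hence at least `1`, which forces modulus one. -/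

/-! ### Fatou's theorem by differentiating a Lipschitz primitive -/

/-- The second-order kernel whose circle average against `G` is `deriv G r`, obtained from the
Cauchy kernel by subtracting its reflection in the unit circle. -/
noncomputable def reflectedCauchyKernel (r : ℝ) (ζ : ℂ) : ℂ :=
  ζ / (ζ - r) ^ 2 - ζ * (r ^ 2 / (1 - r * ζ) ^ 2)

lemma one_sub_ofReal_mul_ne_zero {r : ℝ} (h0 : 0 ≤ r) (h1 : r < 1) {ζ : ℂ} (hζ : ‖ζ‖ ≤ 1) :
    (1 : ℂ) - r * ζ ≠ 0 := by
  intro h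
  have h2 : ‖(r : ℂ) * ζ‖ = 1 := by rw [← sub_eq_zero.1 h]; simp
  rw [norm_mul, Complex.norm_real, Real.norm_of_nonneg h0] at h2
  nlinarith [norm_nonneg ζ]

lemma ofReal_mem_unitBall {r : ℝ} (h0 : 0 ≤ r) (h1 : r < 1) :
    (r : ℂ) ∈ Metric.ball (0 : ℂ) 1 := by
  simpa [abs_of_nonneg h0] using h1

lemma sub_ofReal_ne_zero {r : ℝ} (h0 : 0 ≤ r) (h1 : r < 1) {ζ : ℂ} (hζ : ‖ζ‖ = 1) :
    ζ - r ≠ 0 := by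
  intro h
  rw [sub_eq_zero.1 h, Complex.norm_real, Real.norm_of_nonneg h0] at hζ
  exact h1.ne hζ

lemma norm_one_sub_ofReal_mul {r : ℝ} {ζ : ℂ} (hζ : ‖ζ‖ = 1) :
    ‖(1 : ℂ) - r * ζ‖ = ‖ζ - r‖ := by
  have h : (1 : ℂ) - r * ζ = ζ * (starRingEnd ℂ) (ζ - r) := by
    have h2 : ζ * (starRingEnd ℂ) ζ = 1 := by
      rw [Complex.mul_conj, Complex.normSq_eq_norm_sq, hζ]; simp
    simp only [map_sub, Complex.conj_ofReal, mul_sub, h2]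
    ring
  rw [h, norm_mul, hζ, RCLike.norm_conj, one_mul]

/-- The reflection makes the numerator a difference of squares, `(1 - rζ)² - r²(ζ - r)²`, one of
whose factors is `1 - r²`. This gains a Poisson kernel, whose mean is `1`, over the bare Cauchy
kernel. -/
lemma norm_reflectedCauchyKernel_le {r : ℝ} (h0 : 0 ≤ r) (h1 : r < 1) {ζ : ℂ} (hζ : ‖ζ‖ = 1) :
    ‖reflectedCauchyKernel r ζ‖ ≤ 2 * poissonKernel 0 r ζ / ‖ζ - r‖ := by
  have ha := sub_ofReal_ne_zero h0 h1 hζ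
  have hb := one_sub_ofReal_mul_ne_zero h0 h1 hζ.le
  have h : reflectedCauchyKernel r ζ =
      ζ * (((1 - r * ζ) - r * (ζ - r)) * (1 - r ^ 2)) / ((ζ - r) ^ 2 * (1 - r * ζ) ^ 2) := by
    have hb2 : ((1 : ℂ) - r * ζ) ^ 2 ≠ 0 := pow_ne_zero _ hb
    have ha2 : (ζ - r) ^ 2 ≠ 0 := pow_ne_zero _ ha
    rw [reflectedCauchyKernel, mul_div_assoc', div_sub_div _ _ ha2 hb2]
    ring
  have hr2 : ‖(1 : ℂ) - r ^ 2‖ = 1 - r ^ 2 := by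
    rw [← Complex.ofReal_one, ← Complex.ofReal_pow, ← Complex.ofReal_sub, Complex.norm_real,
      Real.norm_of_nonneg (by nlinarith)]
  have hn : ‖((1 : ℂ) - r * ζ) - r * (ζ - r)‖ ≤ 2 * ‖ζ - r‖ := by
    refine (norm_sub_le _ _).trans ?_
    rw [norm_one_sub_ofReal_mul hζ, norm_mul, Complex.norm_real, Real.norm_of_nonneg h0]
    nlinarith [norm_nonneg (ζ - r)]
  have hp : 0 < ‖ζ - r‖ := norm_pos_iff.2 ha
  rw [h, norm_div, norm_mul, norm_mul, norm_mul, norm_pow, norm_pow, norm_one_sub_ofReal_mul hζ,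
    hζ, hr2, poissonKernel_def]
  simp only [sub_zero, hζ, Complex.norm_real, Real.norm_of_nonneg h0, one_pow, one_mul]
  calc _ ≤ (2 * ‖ζ - r‖ * (1 - r ^ 2)) / (‖ζ - r‖ ^ 2 * ‖ζ - r‖ ^ 2) := by
        gcongr
        nlinarith
    _ = _ := by field_simp

lemma continuousOn_reflectedCauchyKernel {r : ℝ} (h0 : 0 ≤ r) (h1 : r < 1) :
    ContinuousOn (reflectedCauchyKernel r) (Metric.sphere 0 1) := by
  unfold reflectedCauchyKernel
  have ha : ∀ ζ ∈ Metric.sphere (0 : ℂ) 1, (ζ - r) ^ 2 ≠ 0 := fun ζ hζ =>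
    pow_ne_zero _ (sub_ofReal_ne_zero h0 h1 (by simpa using hζ))
  have hb : ∀ ζ ∈ Metric.sphere (0 : ℂ) 1, ((1 : ℂ) - r * ζ) ^ 2 ≠ 0 := fun ζ hζ =>
    pow_ne_zero _ (one_sub_ofReal_mul_ne_zero h0 h1
      (by simpa using (mem_sphere_zero_iff_norm.1 hζ).le))
  exact (continuousOn_id.div (by fun_prop) ha).sub
    (continuousOn_id.mul (continuousOn_const.div (by fun_prop) hb))

/-- Obtained by differentiating in `w` the Herglotz integral, which equals `2 G w - G 0` because `(ζ
+ w) / (ζ - w) = 2ζ / (ζ - w) - 1`. -/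
lemma DiffContOnCl.two_mul_deriv_eq_circleAverage {G : ℂ → ℂ}
    (hG : DiffContOnCl ℂ G (Metric.ball 0 1)) {w : ℂ} (hw : w ∈ Metric.ball (0 : ℂ) 1) :
    2 * deriv G w = Real.circleAverage (fun ζ => (2 * ζ / (ζ - w) ^ 2) • G ζ) 0 1 := by
  have hcont : ContinuousOn G (Metric.sphere 0 1) :=
    hG.2.mono (by rw [closure_ball _ one_ne_zero]; exact Metric.sphere_subset_closedBall)
  have hint : CircleIntegrable G 0 1 := hcont.circleIntegrable zero_le_one
  have hd := hasDerivAt_circleAverage_herglotzRieszKernel_smul hint hw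
  have heq : (fun w ↦ Real.circleAverage (fun ζ ↦ herglotzRieszKernel 0 w ζ • G ζ) 0 1)
      =ᶠ[𝓝 w] fun w => 2 * G w - G 0 := by
    filter_upwards [Metric.isOpen_ball.mem_nhds hw] with v hv
    have hsub : ∀ ζ ∈ Metric.sphere (0 : ℂ) 1, ζ - v ≠ 0 := by
      intro ζ hζ h
      rw [sub_eq_zero.1 h] at hζ
      simp only [mem_sphere_iff_norm, mem_ball_iff_norm, sub_zero] at hζ hv
      exact hv.ne hζ
    have h1 : Real.circleAverage (fun z ↦ ((z - 0) / (z - v)) • G z) 0 1 = G v :=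
      DiffContOnCl.circleAverage_smul_div (by simpa using hG) (by simpa using hv)
    have h2 : Real.circleAverage G 0 1 = G 0 := DiffContOnCl.circleAverage (by simpa using hG)
    have hi : CircleIntegrable (fun z ↦ ((z - 0) / (z - v)) • G z) 0 1 := by
      refine ContinuousOn.circleIntegrable zero_le_one ?_
      exact ((by fun_prop : ContinuousOn (fun z : ℂ => z - 0) _).div (by fun_prop) hsub).smul hcont
    calc _ = Real.circleAverage ((2 : ℂ) • (fun z ↦ ((z - 0) / (z - v)) • G z) - G) 0 1 := by
          refine Real.circleAverage_congr_sphere fun ζ hζ => ?_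
          have := hsub ζ (by simpa using hζ)
          simp only [herglotzRieszKernel_def, sub_zero, Pi.sub_apply, Pi.smul_apply, smul_eq_mul]
          field_simp
          ring
      _ = _ := by
          rw [Real.circleAverage_sub (hi.const_smul) hint, Real.circleAverage_smul, h1, h2,
            smul_eq_mul]
  have hGd : HasDerivAt G (deriv G w) w :=
    (hG.1.differentiableAt (Metric.isOpen_ball.mem_nhds hw)).hasDerivAt
  exact ((hGd.const_mul 2).sub_const (G 0)).unique (hd.congr_of_eventuallyEq heq.symm)

lemma DiffContOnCl.deriv_eq_circleAverage_reflectedCauchyKernel {G : ℂ → ℂ}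
    (hG : DiffContOnCl ℂ G (Metric.ball 0 1)) {r : ℝ} (h0 : 0 ≤ r) (h1 : r < 1) :
    deriv G r = Real.circleAverage (fun ζ => reflectedCauchyKernel r ζ * G ζ) 0 1 := by
  have hcont : ContinuousOn G (Metric.sphere 0 1) :=
    hG.2.mono (by rw [closure_ball _ one_ne_zero]; exact Metric.sphere_subset_closedBall)
  have hd := hG.two_mul_deriv_eq_circleAverage (ofReal_mem_unitBall h0 h1)
  set k : ℂ → ℂ := fun ζ => ζ * (r ^ 2 / (1 - r * ζ) ^ 2) with hk
  have hkG : DiffContOnCl ℂ (fun ζ => k ζ • G ζ) (Metric.ball 0 1) := by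
    refine DiffContOnCl.smul (DifferentiableOn.diffContOnCl ?_) hG
    rw [closure_ball _ one_ne_zero]
    refine differentiableOn_id.mul ((differentiableOn_const _).div (by fun_prop) fun ζ hζ => ?_)
    exact pow_ne_zero _ (one_sub_ofReal_mul_ne_zero h0 h1 (by simpa using hζ))
  -- The reflected term is analytic inside the disc and vanishes at `0`, so subtracting it does not
  -- change the average.
  have hz : Real.circleAverage (fun ζ => k ζ • G ζ) 0 1 = 0 := by
    rw [DiffContOnCl.circleAverage (by simpa using hkG)]
    simp [hk]
  have hkc : ContinuousOn (fun ζ => k ζ • G ζ) (Metric.sphere 0 1) :=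
    hkG.2.mono (by rw [closure_ball _ one_ne_zero]; exact Metric.sphere_subset_closedBall)
  have hc : ContinuousOn (fun ζ => reflectedCauchyKernel r ζ * G ζ) (Metric.sphere 0 1) :=
    (continuousOn_reflectedCauchyKernel h0 h1).mul hcont
  have h2 : Real.circleAverage (fun ζ : ℂ => (2 * ζ / (ζ - r) ^ 2) • G ζ) 0 1 =
      2 * (Real.circleAverage (fun ζ => reflectedCauchyKernel r ζ * G ζ) 0 1 +
        Real.circleAverage (fun ζ => k ζ • G ζ) 0 1) := by
    rw [← Real.circleAverage_add (hc.circleIntegrable zero_le_one)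
        (hkc.circleIntegrable zero_le_one),
      ← smul_eq_mul (2 : ℂ), ← Real.circleAverage_smul]
    congr 1
    ext ζ
    simp only [reflectedCauchyKernel, hk, Pi.smul_apply, Pi.add_apply, smul_eq_mul]
    ring
  rw [h2, hz, add_zero] at hd
  exact mul_left_cancel₀ two_ne_zero hd

lemma circleAverage_poissonKernel {w : ℂ} (hw : w ∈ Metric.ball (0 : ℂ) 1) :
    Real.circleAverage (poissonKernel 0 w) 0 1 = 1 := by
  have h := DiffContOnCl.circleAverage_poissonKernel_smul (f := fun _ => (1 : ℂ))
    (diffContOnCl_const) hw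
  have h2 : (poissonKernel 0 w • fun _ => (1 : ℂ)) = fun ζ => ((poissonKernel 0 w ζ : ℝ) : ℂ) := by
    ext ζ; simp
  rw [h2] at h
  rw [Real.circleAverage_def] at h ⊢
  rw [intervalIntegral.integral_ofReal, Complex.real_smul, ← Complex.ofReal_mul] at h
  exact_mod_cast h

lemma poissonKernel_nonneg {w ζ : ℂ} (hw : w ∈ Metric.ball (0 : ℂ) 1) (hζ : ‖ζ‖ = 1) :
    0 ≤ poissonKernel 0 w ζ := by
  rw [poissonKernel_def]
  have : ‖w‖ < 1 := by simpa using hw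
  simp only [sub_zero, hζ]
  have := norm_nonneg w
  exact div_nonneg (by nlinarith) (by positivity)

lemma continuousOn_poissonKernel {w : ℂ} (hw : w ∈ Metric.ball (0 : ℂ) 1) :
    ContinuousOn (poissonKernel 0 w) (Metric.sphere 0 1) := by
  rw [poissonKernel_eq_re_herglotzRieszKernel]
  have := continuousOn_herglotzRieszKernel_sphere hw
  rw [abs_one] at this
  exact Complex.continuous_re.comp_continuousOn this

lemma norm_circleAverage_le (G : ℂ → ℂ) :
    ‖Real.circleAverage G 0 1‖ ≤ Real.circleAverage (fun ζ => ‖G ζ‖) 0 1 := by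
  rw [Real.circleAverage_def, Real.circleAverage_def, norm_smul,
    Real.norm_of_nonneg (by positivity), smul_eq_mul]
  gcongr
  exact intervalIntegral.norm_integral_le_integral_norm (by positivity)

/-- If `G` is Lipschitz at the boundary point `1` and `G ζ = o(ζ - 1)` along the unit circle, then
`deriv G` tends to `0` radially at `1`. -/
lemma DiffContOnCl.tendsto_deriv_zero {G : ℂ → ℂ} (hG : DiffContOnCl ℂ G (Metric.ball 0 1))
    {M : ℝ} (hM : ∀ ζ, ‖ζ‖ = 1 → ‖G ζ‖ ≤ M * ‖ζ - 1‖)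
    (ho : ∀ ε > 0, ∃ δ > 0, ∀ ζ, ‖ζ‖ = 1 → ‖ζ - 1‖ < δ → ‖G ζ‖ ≤ ε * ‖ζ - 1‖) :
    Tendsto (fun r : ℝ => deriv G r) (𝓝[<] 1) (𝓝 0) := by
  have hM0 : 0 ≤ M := by
    have := (norm_nonneg _).trans (hM (-1) (by simp))
    have h2 : ‖(-1 : ℂ) - 1‖ = 2 := by norm_num
    rw [h2] at this
    linarith
  rw [Metric.tendsto_nhds]
  intro ε hε
  obtain ⟨δ, hδ, hδG⟩ := ho (ε / 8) (by positivity)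
  have hlim : Tendsto (fun r : ℝ => 4 * (ε / 8 + 4 * M * (1 - r ^ 2) / δ ^ 2)) (𝓝[<] 1)
      (𝓝 (4 * (ε / 8 + 4 * M * (1 - 1 ^ 2) / δ ^ 2))) :=
    (Continuous.tendsto (by fun_prop) 1).mono_left nhdsWithin_le_nhds
  have hev := hlim.eventually (gt_mem_nhds (by
    have : 4 * (ε / 8 + 4 * M * (1 - 1 ^ 2) / δ ^ 2) = ε / 2 := by ring
    rw [this]; linarith : _ < ε))
  filter_upwards [hev, Ico_mem_nhdsLT (zero_lt_one' ℝ)] with r hr hr01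
  obtain ⟨h0, h1⟩ := hr01
  rw [dist_zero_right]
  refine lt_of_le_of_lt ?_ hr
  rw [hG.deriv_eq_circleAverage_reflectedCauchyKernel h0 h1]
  have hcont : ContinuousOn G (Metric.sphere 0 1) :=
    hG.2.mono (by rw [closure_ball _ one_ne_zero]; exact Metric.sphere_subset_closedBall)
  have hc : ContinuousOn (fun ζ => reflectedCauchyKernel r ζ * G ζ) (Metric.sphere 0 1) :=
    (continuousOn_reflectedCauchyKernel h0 h1).mul hcont
  have hrb := ofReal_mem_unitBall h0 h1
  have hPi : CircleIntegrable (poissonKernel 0 r) 0 1 :=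
    (continuousOn_poissonKernel hrb).circleIntegrable zero_le_one
  have hr2 : 0 ≤ 1 - r ^ 2 := by nlinarith
  set B : ℝ := 4 * M * (1 - r ^ 2) / δ ^ 2 with hB
  have hB0 : 0 ≤ B := by positivity
  -- Near `1` the little-o bound applies; away from `1` the Lipschitz bound suffices, as the Poisson
  -- kernel is `O(1 - r²)` there. The `4` is the kernel's factor `2` times the `2` of `‖ζ - 1‖ ≤ 2
  -- ‖ζ - r‖`.
  have key : ∀ ζ ∈ Metric.sphere (0 : ℂ) |1|, ‖reflectedCauchyKernel r ζ * G ζ‖ ≤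
      4 * (ε / 8 * poissonKernel 0 r ζ + B) := by
    intro ζ hζ
    have hζ1 : ‖ζ‖ = 1 := by simpa using hζ
    have hs := sub_ofReal_ne_zero h0 h1 hζ1
    have hsp : 0 < ‖ζ - r‖ := norm_pos_iff.2 hs
    have hP := poissonKernel_nonneg hrb hζ1
    have hdist : 1 - r ≤ ‖ζ - r‖ := by
      have := norm_sub_norm_le ζ (r : ℂ)
      rwa [hζ1, Complex.norm_real, Real.norm_of_nonneg h0] at this
    have h12 : ‖ζ - 1‖ ≤ 2 * ‖ζ - r‖ := by
      have h3 : ζ - 1 = (ζ - r) - ((1 - r : ℝ) : ℂ) := by push_cast; ring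
      rw [h3]
      refine (norm_sub_le _ _).trans ?_
      rw [Complex.norm_real, Real.norm_of_nonneg (by linarith)]
      linarith
    have hgen : ∀ t : ℝ, 0 ≤ t → ‖G ζ‖ ≤ t * ‖ζ - 1‖ →
        ‖reflectedCauchyKernel r ζ * G ζ‖ ≤ 4 * (t * poissonKernel 0 r ζ) := by
      intro t ht htG
      rw [norm_mul]
      calc _ ≤ (2 * poissonKernel 0 r ζ / ‖ζ - r‖) * (t * (2 * ‖ζ - r‖)) := by
            gcongr
            · exact norm_reflectedCauchyKernel_le h0 h1 hζ1
            · exact htG.trans (by gcongr)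
        _ = _ := by field_simp; ring
    by_cases hclose : ‖ζ - 1‖ < δ
    · refine (hgen _ (by positivity) (hδG ζ hζ1 hclose)).trans ?_
      linarith
    · refine (hgen M hM0 (hM ζ hζ1)).trans ?_
      have hPle : M * poissonKernel 0 r ζ ≤ B := by
        rw [poissonKernel_def, hB]
        simp only [sub_zero, hζ1, Complex.norm_real, Real.norm_of_nonneg h0, one_pow]
        rw [mul_div_assoc']
        rw [div_le_div_iff₀ (by positivity) (by positivity)]
        have : δ ^ 2 ≤ 4 * ‖ζ - r‖ ^ 2 := by
          have : δ ≤ 2 * ‖ζ - r‖ := (not_lt.1 hclose).trans h12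
          nlinarith
        have hmr : 0 ≤ M * (1 - r ^ 2) := by positivity
        nlinarith
      have : 0 ≤ ε / 8 * poissonKernel 0 r ζ := by positivity
      linarith
  refine (norm_circleAverage_le _).trans ?_
  refine (Real.circleAverage_mono ?_ ?_ key).trans (le_of_eq ?_)
  · exact hc.norm.circleIntegrable zero_le_one
  · refine ContinuousOn.circleIntegrable zero_le_one ?_
    exact continuousOn_const.mul
      ((continuousOn_const.mul (continuousOn_poissonKernel hrb)).add continuousOn_const)
  · have he : (fun ζ => 4 * (ε / 8 * poissonKernel 0 r ζ + B)) =
        (4 : ℝ) • ((ε / 8) • poissonKernel 0 r + fun _ => B) := by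
      ext; simp
    rw [he, Real.circleAverage_smul,
      Real.circleAverage_add hPi.const_smul (circleIntegrable_const _ _ _),
      Real.circleAverage_smul, circleAverage_poissonKernel hrb, Real.circleAverage_const]
    simp

lemma isBigO_arg_sub_one : (fun ζ : ℂ => Complex.arg ζ) =O[𝓝 1] fun ζ => ζ - 1 := by
  have h := (Complex.hasDerivAt_log (z := 1) (by simp)).isBigO_sub
  simp only [Complex.log_one, sub_zero] at h
  refine Asymptotics.IsBigO.trans (Asymptotics.IsBigO.of_bound 1 ?_) h
  filter_upwards with ζ
  rw [one_mul, ← Complex.log_im]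
  exact Complex.abs_im_le_norm _

/-- A function whose restriction to the unit circle has vanishing value and angular derivative
at `1` is `o(ζ - 1)` along the circle. -/
lemma norm_le_of_hasDerivAt_circle_zero {G : ℂ → ℂ}
    (hd : HasDerivAt (fun θ : ℝ => G (Complex.exp (θ * Complex.I))) 0 0) (h1 : G 1 = 0) :
    ∀ ε > 0, ∃ δ > 0, ∀ ζ, ‖ζ‖ = 1 → ‖ζ - 1‖ < δ → ‖G ζ‖ ≤ ε * ‖ζ - 1‖ := by
  intro ε hε
  have ho := hd.isLittleO
  simp only [Complex.ofReal_zero, zero_mul, Complex.exp_zero, h1, sub_zero, smul_zero] at ho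
  have harg : Tendsto (fun ζ : ℂ => Complex.arg ζ) (𝓝 1) (𝓝 0) := by
    have := (Complex.continuousAt_arg (x := 1) (by simp)).tendsto
    rwa [Complex.arg_one] at this
  have ho2 := (ho.comp_tendsto harg).trans_isBigO isBigO_arg_sub_one
  obtain ⟨δ, hδ, hb⟩ := Metric.eventually_nhds_iff.1 (ho2.bound hε)
  refine ⟨δ, hδ, fun ζ hζ hζδ => ?_⟩
  have := hb (y := ζ) (by rwa [dist_eq_norm])
  have he : Complex.exp (Complex.arg ζ * Complex.I) = ζ := by
    have h := Complex.norm_mul_exp_arg_mul_I ζ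
    rwa [hζ, Complex.ofReal_one, one_mul] at h
  simpa only [Function.comp_apply, he] using this

/-- Rotate the point to `1` and subtract the first-order part `A (ζ - 1)`, with `A` chosen so that
`A * I` is the angular derivative. The remainder is `o(ζ - 1)` on the circle, so its derivative `ξ
f(ξ r) - A` tends to `0`. -/
lemma HasRadialLimit.of_primitive {f F : ℂ → ℂ} {K : NNReal} (hF : LipschitzWith K F)
    (hFf : ∀ z ∈ Metric.ball (0 : ℂ) 1, HasDerivAt F (f z) z) {θ : ℝ}
    (hθ : DifferentiableAt ℝ (fun t : ℝ => F (circleMap 0 1 t)) θ) :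
    ∃ η, HasRadialLimit f (circleMap 0 1 θ) η := by
  set ξ := circleMap 0 1 θ with hξ
  have hξ1 : ‖ξ‖ = 1 := by simp [hξ]
  have hξ0 : ξ ≠ 0 := by rw [← norm_pos_iff, hξ1]; exact one_pos
  set D := deriv (fun t : ℝ => F (circleMap 0 1 t)) θ with hD
  set A := D / Complex.I with hA
  set G : ℂ → ℂ := fun ζ => F (ξ * ζ) - F ξ - A * (ζ - 1) with hG
  have hmaps : ∀ z ∈ Metric.ball (0 : ℂ) 1, ξ * z ∈ Metric.ball (0 : ℂ) 1 := by
    intro z hz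
    simpa [hξ1] using hz
  have hGd : ∀ z ∈ Metric.ball (0 : ℂ) 1, HasDerivAt G (ξ * f (ξ * z) - A) z := by
    intro z hz
    have h1 : HasDerivAt (fun z => F (ξ * z)) (f (ξ * z) * (ξ * 1)) z :=
      (hFf _ (hmaps z hz)).comp z ((hasDerivAt_id z).const_mul ξ)
    have h2 := (h1.sub_const (F ξ)).sub (((hasDerivAt_id z).sub_const 1).const_mul A)
    refine h2.congr_deriv ?_
    ring
  have hGc : DiffContOnCl ℂ G (Metric.ball 0 1) :=
    ⟨fun z hz => (hGd z hz).differentiableAt.differentiableWithinAt,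
      (((hF.continuous.comp (by fun_prop)).sub continuous_const).sub (by fun_prop)).continuousOn⟩
  have hM : ∀ ζ, ‖ζ‖ = 1 → ‖G ζ‖ ≤ (K + ‖A‖) * ‖ζ - 1‖ := by
    intro ζ _
    refine (norm_sub_le _ _).trans ?_
    have := hF.dist_le_mul (ξ * ζ) ξ
    rw [dist_eq_norm, dist_eq_norm, show ξ * ζ - ξ = ξ * (ζ - 1) by ring, norm_mul, hξ1,
      one_mul] at this
    rw [norm_mul, add_mul]
    gcongr
  have hφ : HasDerivAt (fun t : ℝ => G (Complex.exp (t * Complex.I))) 0 0 := by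
    have h1 : HasDerivAt (fun t : ℝ => F (circleMap 0 1 (θ + t))) D 0 := by
      refine HasDerivAt.comp_const_add (f := fun t : ℝ => F (circleMap 0 1 t)) θ 0 ?_
      rw [add_zero]
      exact hθ.hasDerivAt
    have h2 : HasDerivAt (fun t : ℝ => Complex.exp (t * Complex.I)) Complex.I 0 := by
      have h3 := (((hasDerivAt_id (0 : ℂ)).mul_const Complex.I).cexp).comp_ofReal (z := 0)
      simpa using h3
    have h4 := (h1.sub_const (F ξ)).sub ((h2.sub_const 1).const_mul A)
    have h5 : D - A * Complex.I = 0 := by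
      rw [hA, div_mul_cancel₀ _ Complex.I_ne_zero, sub_self]
    rw [h5] at h4
    refine h4.congr_of_eventuallyEq (Eventually.of_forall fun t => ?_)
    simp only [hG, hξ, circleMap_zero, Complex.ofReal_one, one_mul, Complex.ofReal_add, add_mul,
      Complex.exp_add, Pi.sub_apply]
  have hlim := hGc.tendsto_deriv_zero hM (norm_le_of_hasDerivAt_circle_zero hφ (by simp [hG]))
  refine ⟨A / ξ, ?_⟩
  have hlim2 : Tendsto (fun r : ℝ => (deriv G r + A) / ξ) (𝓝[<] 1) (𝓝 ((0 + A) / ξ)) :=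
    (hlim.add_const A).div_const ξ
  rw [zero_add] at hlim2
  refine hlim2.congr' ?_
  filter_upwards [Ico_mem_nhdsLT (zero_lt_one' ℝ)] with r hr
  rw [(hGd r (ofReal_mem_unitBall hr.1 hr.2)).deriv, sub_add_cancel, mul_div_cancel_left₀ _ hξ0,
    mul_comm]

/-- Bounded analytic functions on the open unit disc. -/
structure IsBoundedAnalytic (g : ℂ → ℂ) : Prop where
  differentiableOn : DifferentiableOn ℂ g (Metric.ball 0 1)
  bounded : ∃ M, ∀ z ∈ Metric.ball (0 : ℂ) 1, ‖g z‖ ≤ M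

/-- **Fatou's theorem** for bounded analytic functions on the unit disc. -/
theorem IsBoundedAnalytic.ae_exists_hasRadialLimit {g : ℂ → ℂ} (hg : IsBoundedAnalytic g) :
    ∀ᵐ θ : ℝ, ∃ η, HasRadialLimit g (circleMap 0 1 θ) η := by
  obtain ⟨F₀, hF₀⟩ := hg.differentiableOn.isExactOn_ball
  obtain ⟨M, hM⟩ := hg.bounded
  have hL : LipschitzOnWith M.toNNReal F₀ (Metric.ball 0 1) := by
    refine (convex_ball _ _).lipschitzOnWith_of_nnnorm_hasDerivWithin_le
      (fun z hz => (hF₀ z hz).hasDerivWithinAt) fun z hz => ?_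
    rw [← NNReal.coe_le_coe, coe_nnnorm]
    exact (hM z hz).trans (Real.le_coe_toNNReal M)
  -- Extending to the whole plane gives the primitive Lipschitz boundary values, so Rademacher's
  -- theorem applies along the circle.
  obtain ⟨F, hF, hEq⟩ := hL.extend_finite_dimension
  have hFd : ∀ z ∈ Metric.ball (0 : ℂ) 1, HasDerivAt F (g z) z := fun z hz =>
    (hF₀ z hz).congr_of_eventuallyEq
      (eventually_of_mem (Metric.isOpen_ball.mem_nhds hz) fun y hy => (hEq hy).symm)
  have hcirc : LipschitzWith _ (circleMap 0 1) := lipschitzWith_circleMap 0 1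
  filter_upwards [(hF.comp hcirc).ae_differentiableAt_real] with θ hθ
  exact HasRadialLimit.of_primitive hF hFd hθ

/-! ### Harmonic measure and the Poisson formula for bounded analytic functions -/

/-- Harmonic measure of the unit disc seen from `z`, transported to the angular interval
`(0, 2π]`. -/
noncomputable def discHarmonicMeasure (z : ℂ) : Measure ℝ :=
  (volume.restrict (Ioc 0 (2 * Real.pi))).withDensity fun θ =>
    ENNReal.ofReal ((2 * Real.pi)⁻¹ * poissonKernel 0 z (circleMap 0 1 θ))

/-- The boundary function of `g`, in the angular variable. -/
noncomputable def boundaryValue (g : ℂ → ℂ) (θ : ℝ) : ℂ := radialLimit g (circleMap 0 1 θ)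

lemma HasRadialLimit.radialLimit_eq {g : ℂ → ℂ} {ξ η : ℂ} (h : HasRadialLimit g ξ η) :
    radialLimit g ξ = η := Tendsto.limUnder_eq h

lemma measurable_poissonKernel_circleMap (z : ℂ) :
    Measurable fun θ : ℝ => poissonKernel 0 z (circleMap 0 1 θ) := by
  simp only [poissonKernel_def]
  exact Measurable.div (by fun_prop) (by fun_prop)

lemma discHarmonicMeasure_absolutelyContinuous (z : ℂ) : discHarmonicMeasure z ≪ volume :=
  (withDensity_absolutelyContinuous _ _).trans Measure.absolutelyContinuous_restrict

lemma integral_discHarmonicMeasure {E : Type*} [NormedAddCommGroup E] [NormedSpace ℝ E] {z : ℂ}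
    (hz : z ∈ Metric.ball (0 : ℂ) 1) (φ : ℝ → E) :
    ∫ θ, φ θ ∂discHarmonicMeasure z =
      (2 * Real.pi)⁻¹ • ∫ θ in (0 : ℝ)..2 * Real.pi, poissonKernel 0 z (circleMap 0 1 θ) • φ θ := by
  rw [discHarmonicMeasure, integral_withDensity_eq_integral_toReal_smul
    ((measurable_poissonKernel_circleMap z).const_mul _).ennreal_ofReal (by simp),
    intervalIntegral.integral_of_le (by positivity), ← integral_smul]
  refine integral_congr_ae (Eventually.of_forall fun θ => ?_)
  simp only
  rw [ENNReal.toReal_ofReal, mul_smul]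
  exact mul_nonneg (by positivity) (poissonKernel_nonneg hz (by simp))

lemma integrable_discHarmonicMeasure_iff {E : Type*} [NormedAddCommGroup E] [NormedSpace ℝ E]
    {z : ℂ} (hz : z ∈ Metric.ball (0 : ℂ) 1) (φ : ℝ → E) :
    Integrable φ (discHarmonicMeasure z) ↔
      IntervalIntegrable (fun θ => poissonKernel 0 z (circleMap 0 1 θ) • φ θ) volume
        0 (2 * Real.pi) := by
  rw [discHarmonicMeasure, integrable_withDensity_iff_integrable_smul'
    ((measurable_poissonKernel_circleMap z).const_mul _).ennreal_ofReal (by simp),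
    intervalIntegrable_iff_integrableOn_Ioc_of_le (by positivity), IntegrableOn,
    ← integrable_fun_smul_iff (c := (2 * Real.pi)⁻¹) (by positivity)
      (fun θ => poissonKernel 0 z (circleMap 0 1 θ) • φ θ)]
  refine integrable_congr (Eventually.of_forall fun θ => ?_)
  simp only
  rw [ENNReal.toReal_ofReal, mul_smul]
  exact mul_nonneg (by positivity) (poissonKernel_nonneg hz (by simp))

lemma integral_discHarmonicMeasure_eq_circleAverage {E : Type*} [NormedAddCommGroup E]
    [NormedSpace ℝ E] {z : ℂ} (hz : z ∈ Metric.ball (0 : ℂ) 1) (G : ℂ → E) :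
    ∫ θ, G (circleMap 0 1 θ) ∂discHarmonicMeasure z =
      Real.circleAverage (fun ζ => poissonKernel 0 z ζ • G ζ) 0 1 :=
  integral_discHarmonicMeasure hz _

lemma isProbabilityMeasure_discHarmonicMeasure {z : ℂ} (hz : z ∈ Metric.ball (0 : ℂ) 1) :
    IsProbabilityMeasure (discHarmonicMeasure z) := by
  have h := integral_discHarmonicMeasure_eq_circleAverage hz (fun _ => (1 : ℝ))
  simp only [smul_eq_mul, mul_one] at h
  rw [show (fun ζ => poissonKernel 0 z ζ) = poissonKernel 0 z from rfl,
    circleAverage_poissonKernel hz, integral_const, smul_eq_mul, mul_one, Measure.real] at h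
  exact ⟨(ENNReal.toReal_eq_one_iff _).1 h⟩

lemma mul_mem_unitBall {r : ℝ} (h0 : 0 ≤ r) (h1 : r < 1) {ζ : ℂ} (hζ : ‖ζ‖ ≤ 1) :
    (r : ℂ) * ζ ∈ Metric.ball (0 : ℂ) 1 := by
  rw [mem_ball_zero_iff, norm_mul, Complex.norm_real, Real.norm_of_nonneg h0]
  nlinarith [norm_nonneg ζ]

namespace IsBoundedAnalytic

variable {g h : ℂ → ℂ}

lemma ae_hasRadialLimit (hg : IsBoundedAnalytic g) :
    ∀ᵐ θ : ℝ, HasRadialLimit g (circleMap 0 1 θ) (boundaryValue g θ) := by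
  filter_upwards [hg.ae_exists_hasRadialLimit] with θ ⟨η, hη⟩
  rwa [boundaryValue, hη.radialLimit_eq]

lemma continuous_dilate (hg : IsBoundedAnalytic g) {r : ℝ} (h0 : 0 ≤ r) (h1 : r < 1) :
    Continuous fun θ : ℝ => g (r * circleMap 0 1 θ) := by
  refine hg.differentiableOn.continuousOn.comp_continuous (by fun_prop) fun θ => ?_
  exact mul_mem_unitBall h0 h1 (by simp)

lemma aestronglyMeasurable_boundaryValue (hg : IsBoundedAnalytic g) (z : ℂ) :
    AEStronglyMeasurable (boundaryValue g) (discHarmonicMeasure z) := by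
  refine AEStronglyMeasurable.mono_ac (discHarmonicMeasure_absolutelyContinuous z) ?_
  -- The value `0` off `[0, 1)` only secures measurability for every `r`, including those whose
  -- dilation leaves the disc.
  refine aestronglyMeasurable_of_tendsto_ae (u := 𝓝[<] (1 : ℝ))
    (f := fun (r : ℝ) (θ : ℝ) => if 0 ≤ r ∧ r < 1 then g (r * circleMap 0 1 θ) else 0)
    (fun r => ?_) ?_
  · by_cases hr : 0 ≤ r ∧ r < 1
    · simp only [hr, and_self, if_true]
      exact (hg.continuous_dilate hr.1 hr.2).aestronglyMeasurable
    · simp only [hr, if_false]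
      exact aestronglyMeasurable_const
  · filter_upwards [hg.ae_hasRadialLimit] with θ hθ
    refine Tendsto.congr' ?_ hθ
    filter_upwards [Ico_mem_nhdsLT (zero_lt_one' ℝ)] with r hr
    simp [hr.1, hr.2]

lemma ae_norm_boundaryValue_le {M : ℝ} (hg : IsBoundedAnalytic g)
    (hM : ∀ z ∈ Metric.ball (0 : ℂ) 1, ‖g z‖ ≤ M) : ∀ᵐ θ : ℝ, ‖boundaryValue g θ‖ ≤ M := by
  filter_upwards [hg.ae_hasRadialLimit] with θ hθ
  refine le_of_tendsto hθ.norm ?_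
  filter_upwards [Ico_mem_nhdsLT (zero_lt_one' ℝ)] with r hr
  exact hM _ (mul_mem_unitBall hr.1 hr.2 (by simp))

lemma memLp_boundaryValue (hg : IsBoundedAnalytic g) {z : ℂ} (hz : z ∈ Metric.ball (0 : ℂ) 1)
    (p : ENNReal) : MemLp (boundaryValue g) p (discHarmonicMeasure z) := by
  have := isProbabilityMeasure_discHarmonicMeasure hz
  obtain ⟨M, hM⟩ := hg.bounded
  exact MemLp.of_bound (hg.aestronglyMeasurable_boundaryValue z) M
    ((discHarmonicMeasure_absolutelyContinuous z).ae_le (hg.ae_norm_boundaryValue_le hM))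

lemma integrable_boundaryValue (hg : IsBoundedAnalytic g) {z : ℂ}
    (hz : z ∈ Metric.ball (0 : ℂ) 1) : Integrable (boundaryValue g) (discHarmonicMeasure z) :=
  memLp_one_iff_integrable.1 (hg.memLp_boundaryValue hz 1)

lemma integral_dilate (hg : IsBoundedAnalytic g) {z : ℂ} (hz : z ∈ Metric.ball (0 : ℂ) 1)
    {r : ℝ} (h0 : 0 ≤ r) (h1 : r < 1) :
    ∫ θ, g (r * circleMap 0 1 θ) ∂discHarmonicMeasure z = g (r * z) := by
  rw [integral_discHarmonicMeasure_eq_circleAverage hz (fun ζ => g (r * ζ))]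
  refine DiffContOnCl.circleAverage_poissonKernel_smul (f := fun ζ => g (r * ζ)) ?_ hz
  refine DifferentiableOn.diffContOnCl ?_
  rw [closure_ball _ one_ne_zero]
  exact hg.differentiableOn.comp (by fun_prop) fun ζ hζ =>
    mul_mem_unitBall h0 h1 (by simpa using hζ)

/-- Integrals of continuous functions of dilations converge to those of the boundary function. -/
lemma tendsto_integral_dilate {E : Type*} [NormedAddCommGroup E] [NormedSpace ℝ E]
    (hg : IsBoundedAnalytic g) {z : ℂ}
    (hz : z ∈ Metric.ball (0 : ℂ) 1) {Φ : ℂ → E} (hΦ : Continuous Φ) :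
    Tendsto (fun r : ℝ => ∫ θ, Φ (g (r * circleMap 0 1 θ)) ∂discHarmonicMeasure z) (𝓝[<] 1)
      (𝓝 (∫ θ, Φ (boundaryValue g θ) ∂discHarmonicMeasure z)) := by
  have := isProbabilityMeasure_discHarmonicMeasure hz
  obtain ⟨M, hM⟩ := hg.bounded
  obtain ⟨B, hB⟩ := (isCompact_closedBall (0 : ℂ) M).exists_bound_of_continuousOn hΦ.continuousOn
  refine tendsto_integral_filter_of_dominated_convergence (fun _ => B) ?_ ?_
    (integrable_const _) ?_
  · filter_upwards [Ico_mem_nhdsLT (zero_lt_one' ℝ)] with r hr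
    exact (hΦ.comp (hg.continuous_dilate hr.1 hr.2)).aestronglyMeasurable
  · filter_upwards [Ico_mem_nhdsLT (zero_lt_one' ℝ)] with r hr
    refine Eventually.of_forall fun θ => hB _ ?_
    exact mem_closedBall_zero_iff.2 (hM _ (mul_mem_unitBall hr.1 hr.2 (by simp)))
  · refine (discHarmonicMeasure_absolutelyContinuous z).ae_le ?_
    filter_upwards [hg.ae_hasRadialLimit] with θ hθ
    exact (hΦ.tendsto _).comp hθ

/-- The Poisson integral of the boundary function recovers the function. -/
theorem integral_boundaryValue (hg : IsBoundedAnalytic g) {z : ℂ}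
    (hz : z ∈ Metric.ball (0 : ℂ) 1) :
    ∫ θ, boundaryValue g θ ∂discHarmonicMeasure z = g z := by
  refine tendsto_nhds_unique (hg.tendsto_integral_dilate hz continuous_id) ?_
  have hcont : Tendsto (fun r : ℝ => g (r * z)) (𝓝[<] 1) (𝓝 (g z)) := by
    have h1 : ContinuousAt g z :=
      hg.differentiableOn.continuousOn.continuousAt (Metric.isOpen_ball.mem_nhds hz)
    have h2 : Tendsto (fun r : ℝ => (r : ℂ) * z) (𝓝[<] 1) (𝓝 z) := by
      have : Continuous fun r : ℝ => (r : ℂ) * z := by fun_prop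
      simpa using (this.tendsto 1).mono_left nhdsWithin_le_nhds
    exact h1.tendsto.comp h2
  refine hcont.congr' ?_
  filter_upwards [Ico_mem_nhdsLT (zero_lt_one' ℝ)] with r hr
  exact (hg.integral_dilate hz hr.1 hr.2).symm

lemma mul (hg : IsBoundedAnalytic g) (hh : IsBoundedAnalytic h) :
    IsBoundedAnalytic fun z => g z * h z := by
  refine ⟨hg.differentiableOn.mul hh.differentiableOn, ?_⟩
  obtain ⟨M, hM⟩ := hg.bounded
  obtain ⟨B, hB⟩ := hh.bounded
  refine ⟨M * B, fun z hz => ?_⟩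
  rw [norm_mul]
  exact mul_le_mul (hM z hz) (hB z hz) (norm_nonneg _) ((norm_nonneg _).trans (hM z hz))

lemma comp (hg : IsBoundedAnalytic g) (hh : IsBoundedAnalytic h)
    (hmaps : MapsTo h (Metric.ball 0 1) (Metric.ball 0 1)) : IsBoundedAnalytic (g ∘ h) := by
  refine ⟨hg.differentiableOn.comp hh.differentiableOn hmaps, ?_⟩
  obtain ⟨M, hM⟩ := hg.bounded
  exact ⟨M, fun z hz => hM _ (hmaps hz)⟩

lemma boundaryValue_mul (hg : IsBoundedAnalytic g) (hh : IsBoundedAnalytic h) :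
    ∀ᵐ θ : ℝ, boundaryValue (fun z => g z * h z) θ = boundaryValue g θ * boundaryValue h θ := by
  filter_upwards [hg.ae_hasRadialLimit, hh.ae_hasRadialLimit] with θ h1 h2
  exact HasRadialLimit.radialLimit_eq (Tendsto.mul h1 h2)

end IsBoundedAnalytic

/-! ### Hardy norms and Taylor coefficients under composition -/

lemma zero_mem_unitBall : (0 : ℂ) ∈ Metric.ball (0 : ℂ) 1 := Metric.mem_ball_self one_pos

lemma norm_dslope_zero_le {h : ℂ → ℂ} (hd : DifferentiableOn ℂ h (Metric.ball 0 1)) {M : ℝ}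
    (hM : ∀ z ∈ Metric.ball (0 : ℂ) 1, ‖h z‖ ≤ M) {z : ℂ} (hz : z ∈ Metric.ball (0 : ℂ) 1) :
    ‖dslope h 0 z‖ ≤ M + ‖h 0‖ := by
  have := Complex.norm_dslope_le_div_of_mapsTo_ball (R₂ := M + ‖h 0‖) hd (fun w hw => ?_) hz
  · simpa using this
  · rw [mem_closedBall_iff_norm]
    exact (norm_sub_le _ _).trans (by gcongr; exact hM w hw)

lemma eq_add_mul_dslope_zero (h : ℂ → ℂ) (z : ℂ) : h z = h 0 + z * dslope h 0 z := by
  have := sub_smul_dslope h 0 z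
  rw [sub_zero, smul_eq_mul] at this
  rw [this]
  ring

lemma differentiableOn_dslope_zero {h : ℂ → ℂ} (hd : DifferentiableOn ℂ h (Metric.ball 0 1)) :
    DifferentiableOn ℂ (dslope h 0) (Metric.ball 0 1) :=
  (Complex.differentiableOn_dslope (Metric.ball_mem_nhds _ one_pos)).2 hd

lemma IsBoundedAnalytic.dslope {h : ℂ → ℂ} (hh : IsBoundedAnalytic h) :
    IsBoundedAnalytic (dslope h 0) := by
  obtain ⟨M, hM⟩ := hh.bounded
  exact ⟨differentiableOn_dslope_zero hh.differentiableOn, M + ‖h 0‖,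
    fun z hz => norm_dslope_zero_le hh.differentiableOn hM hz⟩

/-- The squared Hardy norm of a function on the disc, computed on the boundary. -/
noncomputable def hardySq (h : ℂ → ℂ) : ℝ := ∫ θ, ‖boundaryValue h θ‖ ^ 2 ∂discHarmonicMeasure 0

lemma hardySq_nonneg (h : ℂ → ℂ) : 0 ≤ hardySq h := integral_nonneg fun _ => by positivity

lemma hardySq_le {h : ℂ → ℂ} (hh : IsBoundedAnalytic h) {M : ℝ}
    (hM : ∀ z ∈ Metric.ball (0 : ℂ) 1, ‖h z‖ ≤ M) : hardySq h ≤ M ^ 2 := by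
  have := isProbabilityMeasure_discHarmonicMeasure zero_mem_unitBall
  have hle : hardySq h ≤ ∫ _, M ^ 2 ∂discHarmonicMeasure 0 := by
    refine integral_mono_ae ?_ (integrable_const _) ?_
    · exact (hh.memLp_boundaryValue zero_mem_unitBall 2).integrable_norm_pow two_ne_zero
    · refine (discHarmonicMeasure_absolutelyContinuous 0).ae_le ?_
      filter_upwards [hh.ae_norm_boundaryValue_le hM] with θ hθ
      exact pow_le_pow_left₀ (norm_nonneg _) hθ 2
  simpa using hle

/-- Removing the constant coefficient of `h` in `h ∘ g`, where `g 0 = 0` and `g` has constant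
boundary modulus `ρ`. -/
lemma hardySq_comp_eq {g h : ℂ → ℂ} {ρ : ℝ} (hg : IsBoundedAnalytic g)
    (hmaps : MapsTo g (Metric.ball 0 1) (Metric.ball 0 1)) (hg0 : g 0 = 0)
    (hρ : ∀ᵐ θ : ℝ, ‖boundaryValue g θ‖ = ρ) (hh : IsBoundedAnalytic h) :
    hardySq (h ∘ g) = ‖h 0‖ ^ 2 + ρ ^ 2 * hardySq (dslope h 0 ∘ g) := by
  have := isProbabilityMeasure_discHarmonicMeasure zero_mem_unitBall
  have hq := hh.dslope.comp hg hmaps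
  have hgq := hg.mul hq
  set q := dslope h 0 ∘ g with hqdef
  have hb : ∀ᵐ θ : ℝ, boundaryValue (h ∘ g) θ = h 0 + boundaryValue (fun z => g z * q z) θ := by
    filter_upwards [hgq.ae_hasRadialLimit] with θ hθ
    refine HasRadialLimit.radialLimit_eq ((Tendsto.const_add (h 0) hθ).congr fun r => ?_)
    exact (eq_add_mul_dslope_zero h _).symm
  have hpt : ∀ᵐ θ ∂discHarmonicMeasure 0, ‖boundaryValue (h ∘ g) θ‖ ^ 2 =
      (‖h 0‖ ^ 2 + ρ ^ 2 * ‖boundaryValue q θ‖ ^ 2) +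
        (2 * ((starRingEnd ℂ) (h 0) * boundaryValue (fun z => g z * q z) θ)).re := by
    refine (discHarmonicMeasure_absolutelyContinuous 0).ae_le ?_
    filter_upwards [hb, hg.boundaryValue_mul hq, hρ] with θ h1 h2 h3
    have h4 : ‖boundaryValue (fun z => g z * q z) θ‖ ^ 2 = ρ ^ 2 * ‖boundaryValue q θ‖ ^ 2 := by
      rw [h2, norm_mul, h3, mul_pow]
    rw [h1, ← h4, ← Complex.normSq_eq_norm_sq, ← Complex.normSq_eq_norm_sq,
      ← Complex.normSq_eq_norm_sq]
    simp only [Complex.normSq_apply, Complex.add_re, Complex.add_im, Complex.mul_re,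
      Complex.mul_im, Complex.conj_re, Complex.conj_im, Complex.re_ofNat, Complex.im_ofNat]
    ring
  have hi1 : Integrable (fun θ => ‖boundaryValue q θ‖ ^ 2) (discHarmonicMeasure 0) :=
    (hq.memLp_boundaryValue zero_mem_unitBall 2).integrable_norm_pow two_ne_zero
  have hi2 : Integrable (fun θ => 2 * ((starRingEnd ℂ) (h 0) *
      boundaryValue (fun z => g z * q z) θ)) (discHarmonicMeasure 0) :=
    ((hgq.integrable_boundaryValue zero_mem_unitBall).const_mul _).const_mul _
  have hi3 : Integrable (fun θ => (2 * ((starRingEnd ℂ) (h 0) *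
      boundaryValue (fun z => g z * q z) θ)).re) (discHarmonicMeasure 0) := hi2.re
  -- The cross term integrates to a multiple of the value of `g * q` at `0`, and `g 0 = 0`.
  have hzero : ∫ θ, (2 * ((starRingEnd ℂ) (h 0) * boundaryValue (fun z => g z * q z) θ)).re
      ∂discHarmonicMeasure 0 = 0 := by
    have h1 := integral_re hi2
    simp only [RCLike.re_eq_complex_re] at h1
    rw [h1, integral_const_mul, integral_const_mul, hgq.integral_boundaryValue zero_mem_unitBall,
      hg0]
    simp
  rw [hardySq, integral_congr_ae hpt, integral_add _ hi3, hzero, add_zero,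
    integral_add (integrable_const _) (hi1.const_mul _), integral_const_mul, hardySq]
  · simp
  · exact (integrable_const _).add (hi1.const_mul _)

/-- Iterated removal of Taylor coefficients. -/
lemma hardySq_comp_eq_sum {g h : ℂ → ℂ} {ρ : ℝ} (hg : IsBoundedAnalytic g)
    (hmaps : MapsTo g (Metric.ball 0 1) (Metric.ball 0 1)) (hg0 : g 0 = 0)
    (hρ : ∀ᵐ θ : ℝ, ‖boundaryValue g θ‖ = ρ) (hh : IsBoundedAnalytic h) (K : ℕ) :
    IsBoundedAnalytic ((fun u => dslope u 0)^[K] h) ∧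
    hardySq (h ∘ g) = ∑ k ∈ Finset.range K, (ρ ^ k) ^ 2 * ‖(fun u => dslope u 0)^[k] h 0‖ ^ 2 +
      (ρ ^ K) ^ 2 * hardySq ((fun u => dslope u 0)^[K] h ∘ g) := by
  induction K with
  | zero => simpa using hh
  | succ K ih =>
    rw [Function.iterate_succ_apply']
    refine ⟨ih.1.dslope, ?_⟩
    rw [ih.2, hardySq_comp_eq hg hmaps hg0 hρ ih.1, Finset.sum_range_succ]
    ring

lemma isBoundedAnalytic_const_mul (c : ℂ) : IsBoundedAnalytic fun z => c * z := by
  refine ⟨by fun_prop, ‖c‖, fun z hz => ?_⟩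
  rw [norm_mul]
  exact mul_le_of_le_one_right (norm_nonneg _) (by simpa using (mem_ball_zero_iff.1 hz).le)

lemma boundaryValue_const_mul (c : ℂ) (θ : ℝ) :
    boundaryValue (fun z => c * z) θ = c * circleMap 0 1 θ := by
  refine HasRadialLimit.radialLimit_eq ?_
  have : Continuous fun r : ℝ => c * ((r : ℂ) * circleMap 0 1 θ) := by fun_prop
  simpa [HasRadialLimit] using (this.tendsto 1).mono_left nhdsWithin_le_nhds

/-- Taking `g` to be the identity, Bessel's inequality bounds every Taylor coefficient by `1`; each
`dslope` then adds at most one coefficient to the bound. Growth linear in `K` is enough against `r ^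
K`. -/
lemma norm_iterate_dslope_le {f : ℂ → ℂ} (hf : IsBoundedAnalytic f)
    (hf1 : ∀ z ∈ Metric.ball (0 : ℂ) 1, ‖f z‖ ≤ 1) (K : ℕ) {z : ℂ}
    (hz : z ∈ Metric.ball (0 : ℂ) 1) : ‖(fun u => dslope u 0)^[K] f z‖ ≤ 1 + K := by
  have hid : IsBoundedAnalytic fun z => (1 : ℂ) * z := isBoundedAnalytic_const_mul 1
  have hidm : MapsTo (fun z => (1 : ℂ) * z) (Metric.ball 0 1) (Metric.ball 0 1) := by
    intro z hz; simpa using hz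
  have hsum := hardySq_comp_eq_sum (ρ := 1) hid hidm (by simp)
    (by filter_upwards with θ; rw [boundaryValue_const_mul]; simp) hf
  have hcoef : ∀ k, ‖(fun u => dslope u 0)^[k] f 0‖ ≤ 1 := by
    intro k
    have h1 := (hsum (k + 1)).2
    rw [Finset.sum_range_succ] at h1
    have h2 : hardySq (f ∘ fun z => (1 : ℂ) * z) ≤ 1 ^ 2 := hardySq_le (hf.comp hid hidm)
      fun z hz => hf1 _ (hidm hz)
    have h3 := hardySq_nonneg ((fun u => dslope u 0)^[k + 1] f ∘ fun z => (1 : ℂ) * z)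
    have h4 : 0 ≤ ∑ k ∈ Finset.range k, ((1 : ℝ) ^ k) ^ 2 * ‖(fun u => dslope u 0)^[k] f 0‖ ^ 2 :=
      Finset.sum_nonneg fun _ _ => by positivity
    simp only [one_pow, one_mul] at h1 h2 h3 h4
    have h5 : ‖(fun u => dslope u 0)^[k] f 0‖ ^ 2 ≤ 1 := by linarith
    exact (sq_le_one_iff₀ (norm_nonneg _)).1 h5
  induction K generalizing z with
  | zero => simpa using hf1 z hz
  | succ K ih =>
    rw [Function.iterate_succ_apply']
    refine (norm_dslope_zero_le (hsum K).1.differentiableOn (fun w hw => ih hw) hz).trans ?_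
    push_cast
    linarith [hcoef K]

/-- Composition with `g` does not decrease the Hardy norm below that of any dilation. -/
lemma hardySq_dilate_le_hardySq_comp {f g : ℂ → ℂ} (hg : IsBoundedAnalytic g)
    (hmaps : MapsTo g (Metric.ball 0 1) (Metric.ball 0 1)) (hg0 : g 0 = 0)
    (hg1 : ∀ᵐ θ : ℝ, ‖boundaryValue g θ‖ = 1) (hf : IsBoundedAnalytic f)
    (hf1 : ∀ z ∈ Metric.ball (0 : ℂ) 1, ‖f z‖ ≤ 1) {r : ℝ} (h0 : 0 ≤ r) (h1 : r < 1) :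
    hardySq (f ∘ fun z => (r : ℂ) * z) ≤ hardySq (f ∘ g) := by
  have hid : IsBoundedAnalytic fun z => (r : ℂ) * z := isBoundedAnalytic_const_mul r
  have hidm : MapsTo (fun z => (r : ℂ) * z) (Metric.ball 0 1) (Metric.ball 0 1) := fun z hz =>
    mul_mem_unitBall h0 h1 (mem_ball_zero_iff.1 hz).le
  have hr : ∀ᵐ θ : ℝ, ‖boundaryValue (fun z => (r : ℂ) * z) θ‖ = r := by
    filter_upwards with θ
    simp [boundaryValue_const_mul, abs_of_nonneg h0]
  -- Both expansions have the same coefficients, with weights `r^(2k)` for the dilation and `1` for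
  -- `g`; only the dilation's remainder needs an upper bound.
  have hbound : ∀ K : ℕ, hardySq (f ∘ fun z => (r : ℂ) * z) ≤
      hardySq (f ∘ g) + (r ^ K * (1 + K)) ^ 2 := by
    intro K
    rw [(hardySq_comp_eq_sum hid hidm (by simp) hr hf K).2,
      (hardySq_comp_eq_sum hg hmaps hg0 hg1 hf K).2]
    have hfK := (hardySq_comp_eq_sum hg hmaps hg0 hg1 hf K).1
    have h2 := hardySq_le (hfK.comp hid hidm) (M := 1 + K)
      fun z hz => norm_iterate_dslope_le hf hf1 K (hidm hz)
    have h3 := hardySq_nonneg ((fun u => dslope u 0)^[K] f ∘ g)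
    simp only [one_pow, one_mul]
    have h4 : ∑ k ∈ Finset.range K, (r ^ k) ^ 2 * ‖(fun u => dslope u 0)^[k] f 0‖ ^ 2 ≤
        ∑ k ∈ Finset.range K, ‖(fun u => dslope u 0)^[k] f 0‖ ^ 2 := by
      refine Finset.sum_le_sum fun k _ => mul_le_of_le_one_left (by positivity) ?_
      exact pow_le_one₀ (by positivity) (pow_le_one₀ h0 h1.le)
    rw [mul_pow]
    have : (r ^ K) ^ 2 * hardySq ((fun u => dslope u 0)^[K] f ∘ fun z => (r : ℂ) * z) ≤
        (r ^ K) ^ 2 * (1 + K) ^ 2 := by gcongr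
    linarith
  have hlim : Tendsto (fun K : ℕ => hardySq (f ∘ g) + (r ^ K * (1 + K)) ^ 2) atTop
      (𝓝 (hardySq (f ∘ g) + (0 + 0) ^ 2)) := by
    have ha := tendsto_pow_atTop_nhds_zero_of_lt_one h0 h1
    have hb := tendsto_self_mul_const_pow_of_lt_one h0 h1
    refine Tendsto.const_add _ (Tendsto.pow ((ha.add hb).congr fun K => ?_) 2)
    ring
  have := ge_of_tendsto' hlim hbound
  simpa using this

/-! ### Composition and iteration of inner functions -/

lemma ae_of_ae_restrict_Ioc_of_periodic {p : ℂ → Prop}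
    (h : ∀ᵐ θ ∂(volume.restrict (Ioc 0 (2 * Real.pi))), p (circleMap 0 1 θ)) :
    ∀ᵐ θ : ℝ, p (circleMap 0 1 θ) := by
  have hpi : 0 < 2 * Real.pi := by positivity
  have hcover : (univ : Set ℝ) =
      ⋃ n : ℤ, Ioc (0 + n • (2 * Real.pi)) (0 + (n + 1) • (2 * Real.pi)) :=
    (iUnion_Ioc_add_zsmul hpi 0).symm
  rw [ae_restrict_iff' measurableSet_Ioc] at h
  have hall : ∀ n : ℤ, ∀ᵐ θ : ℝ, θ - n * (2 * Real.pi) ∈ Ioc 0 (2 * Real.pi) →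
      p (circleMap 0 1 (θ - n * (2 * Real.pi))) := fun n =>
    (measurePreserving_sub_right volume ((n : ℝ) * (2 * Real.pi))).quasiMeasurePreserving.ae h
  filter_upwards [ae_all_iff.2 hall] with θ hθ
  obtain ⟨n, hn⟩ := mem_iUnion.1 (hcover ▸ mem_univ θ)
  have := hθ n (by
    simp only [zero_add, zsmul_eq_mul, Int.cast_add, Int.cast_one, mem_Ioc] at hn ⊢
    constructor <;> linarith [hn.1, hn.2])
  rwa [show circleMap 0 1 (θ - n * (2 * Real.pi)) = circleMap 0 1 θ from
    (periodic_circleMap 0 1).sub_int_mul_eq n] at this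

/-- The Poisson kernel at the origin is a positive constant on the circle, so the two measures have
the same null sets. -/
lemma ae_restrict_of_ae_discHarmonicMeasure_zero {p : ℝ → Prop}
    (h : ∀ᵐ θ ∂discHarmonicMeasure 0, p θ) :
    ∀ᵐ θ ∂(volume.restrict (Ioc 0 (2 * Real.pi))), p θ := by
  refine (withDensity_absolutelyContinuous' ?_ ?_).ae_le h
  · exact ((measurable_poissonKernel_circleMap 0).const_mul _).ennreal_ofReal.aemeasurable
  · refine Eventually.of_forall fun θ => ?_
    simp [poissonKernel_def, Real.pi_pos]

lemma IsInnerFunction.isBoundedAnalytic {g : ℂ → ℂ} (hg : IsInnerFunction g) :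
    IsBoundedAnalytic g :=
  ⟨hg.differentiableOn, 1, fun _ hz => (mem_ball_zero_iff.1 (hg.mapsTo hz)).le⟩

lemma IsInnerFunction.ae_norm_boundaryValue {g : ℂ → ℂ} (hg : IsInnerFunction g) :
    ∀ᵐ θ : ℝ, ‖boundaryValue g θ‖ = 1 := by
  filter_upwards [hg.ae_radialLimit] with θ ⟨η, hη1, hη⟩
  rw [boundaryValue, hη.radialLimit_eq, hη1]

/-- The composition of inner functions is inner, if the inner one fixes the origin. -/
theorem IsInnerFunction.comp {f g : ℂ → ℂ} (hf : IsInnerFunction f) (hg : IsInnerFunction g)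
    (hg0 : g 0 = 0) : IsInnerFunction (f ∘ g) := by
  have := isProbabilityMeasure_discHarmonicMeasure zero_mem_unitBall
  have hfb := hf.isBoundedAnalytic
  have hgb := hg.isBoundedAnalytic
  have hfg := hfb.comp hgb hg.mapsTo
  have hf1 : ∀ z ∈ Metric.ball (0 : ℂ) 1, ‖f z‖ ≤ 1 := fun z hz =>
    (mem_ball_zero_iff.1 (hf.mapsTo hz)).le
  have hlim := hfb.tendsto_integral_dilate zero_mem_unitBall
    (Φ := fun w => ‖w‖ ^ 2) (by fun_prop)
  have hone : ∫ θ, ‖boundaryValue f θ‖ ^ 2 ∂discHarmonicMeasure 0 = 1 := by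
    rw [integral_congr_ae (g := fun _ => (1 : ℝ))]
    · simp
    · refine (discHarmonicMeasure_absolutelyContinuous 0).ae_le ?_
      filter_upwards [hf.ae_norm_boundaryValue] with θ hθ
      simp [hθ]
  rw [hone] at hlim
  have hge : 1 ≤ hardySq (f ∘ g) := by
    refine le_of_tendsto hlim ?_
    filter_upwards [Ico_mem_nhdsLT (zero_lt_one' ℝ)] with r hr
    refine le_trans (le_of_eq ?_) (hardySq_dilate_le_hardySq_comp hgb hg.mapsTo hg0
      hg.ae_norm_boundaryValue hfb hf1 hr.1 hr.2)
    refine integral_congr_ae (Eventually.of_forall fun θ => ?_)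
    have hbv : boundaryValue (f ∘ fun z => (r : ℂ) * z) θ = f (r * circleMap 0 1 θ) := by
      refine HasRadialLimit.radialLimit_eq ?_
      have hm := mul_mem_unitBall hr.1 hr.2 (ζ := circleMap 0 1 θ) (by simp)
      have h1 : ContinuousAt f (r * circleMap 0 1 θ) :=
        hf.differentiableOn.continuousOn.continuousAt (Metric.isOpen_ball.mem_nhds hm)
      have h2 : Continuous fun s : ℝ => (r : ℂ) * ((s : ℂ) * circleMap 0 1 θ) := by fun_prop
      have h3 : Tendsto (fun s : ℝ => (r : ℂ) * ((s : ℂ) * circleMap 0 1 θ)) (𝓝[<] 1)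
          (𝓝 (r * circleMap 0 1 θ)) := by
        simpa using (h2.tendsto 1).mono_left nhdsWithin_le_nhds
      exact h1.tendsto.comp h3
    simp only [hbv]
  have hle : ∀ᵐ θ : ℝ, ‖boundaryValue (f ∘ g) θ‖ ≤ 1 :=
    hfg.ae_norm_boundaryValue_le fun z hz => hf1 _ (hg.mapsTo hz)
  have hi : Integrable (fun θ => ‖boundaryValue (f ∘ g) θ‖ ^ 2) (discHarmonicMeasure 0) :=
    (hfg.memLp_boundaryValue zero_mem_unitBall 2).integrable_norm_pow two_ne_zero
  have hnn : 0 ≤ᵐ[discHarmonicMeasure 0] fun θ => 1 - ‖boundaryValue (f ∘ g) θ‖ ^ 2 := by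
    refine (discHarmonicMeasure_absolutelyContinuous 0).ae_le ?_
    filter_upwards [hle] with θ hθ
    have := pow_le_one₀ (n := 2) (norm_nonneg _) hθ
    simpa using this
  -- The integrand is nonnegative and `hge` makes its integral at most `0`, so it vanishes almost
  -- everywhere.
  have hint0 : ∫ θ, (1 - ‖boundaryValue (f ∘ g) θ‖ ^ 2) ∂discHarmonicMeasure 0 = 0 := by
    refine le_antisymm ?_ (integral_nonneg_of_ae hnn)
    rw [integral_sub (integrable_const _) hi]
    simp only [integral_const, probReal_univ, smul_eq_mul, mul_one]
    rw [hardySq] at hge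
    linarith
  have hae := (integral_eq_zero_iff_of_nonneg_ae hnn ((integrable_const _).sub hi)).1 hint0
  have hae1 : ∀ᵐ θ : ℝ, ‖boundaryValue (f ∘ g) θ‖ = 1 := by
    refine ae_of_ae_restrict_Ioc_of_periodic (p := fun ξ => ‖radialLimit (f ∘ g) ξ‖ = 1) ?_
    filter_upwards [ae_restrict_of_ae_discHarmonicMeasure_zero hae] with θ hθ
    have h1 : ‖boundaryValue (f ∘ g) θ‖ ^ 2 = 1 := by
      simp only [Pi.zero_apply] at hθ
      linarith
    exact (pow_eq_one_iff_of_nonneg (norm_nonneg _) two_ne_zero).1 h1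
  refine ⟨hfg.differentiableOn, hf.mapsTo.comp hg.mapsTo, ?_⟩
  filter_upwards [hae1, hfg.ae_hasRadialLimit] with θ h1 h2
  exact ⟨_, h1, h2⟩

theorem IsInnerFunction.iterate {f : ℂ → ℂ} (hf : IsInnerFunction f) (hf0 : f 0 = 0) {n : ℕ}
    (hn : 1 ≤ n) : IsInnerFunction (f^[n]) := by
  induction n, hn using Nat.le_induction with
  | base => simpa using hf
  | succ n _ ih =>
    rw [Function.iterate_succ']
    exact hf.comp ih (Function.iterate_fixed hf0 n)

/-! ### Schwarz–Pick estimates -/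

lemma normSq_one_sub_conj_mul_sub (a t : ℂ) :
    ‖1 - (starRingEnd ℂ) a * t‖ ^ 2 - ‖t - a‖ ^ 2 = (1 - ‖a‖ ^ 2) * (1 - ‖t‖ ^ 2) := by
  simp only [← Complex.normSq_eq_norm_sq, Complex.normSq_apply, Complex.sub_re, Complex.sub_im,
    Complex.mul_re, Complex.mul_im, Complex.conj_re, Complex.conj_im, Complex.one_re,
    Complex.one_im]
  ring

/-- **Schwarz–Pick inequality** based at the origin. -/
lemma norm_sub_le_of_mapsTo_unitBall {h : ℂ → ℂ} (hd : DifferentiableOn ℂ h (Metric.ball 0 1))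
    (hmaps : MapsTo h (Metric.ball 0 1) (Metric.ball 0 1)) {w : ℂ}
    (hw : w ∈ Metric.ball (0 : ℂ) 1) :
    ‖h w - h 0‖ ≤ ‖w‖ * ‖1 - (starRingEnd ℂ) (h 0) * h w‖ := by
  have ha : ‖h 0‖ < 1 := mem_ball_zero_iff.1 (hmaps zero_mem_unitBall)
  have hpos : ∀ z ∈ Metric.ball (0 : ℂ) 1, 0 < ‖1 - (starRingEnd ℂ) (h 0) * h z‖ := by
    intro z hz
    have hz1 : ‖h z‖ < 1 := mem_ball_zero_iff.1 (hmaps hz)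
    have h1 : ‖(starRingEnd ℂ) (h 0) * h z‖ < 1 := by
      rw [norm_mul, RCLike.norm_conj]
      nlinarith [norm_nonneg (h 0), norm_nonneg (h z)]
    have h2 := norm_sub_norm_le (1 : ℂ) ((starRingEnd ℂ) (h 0) * h z)
    rw [norm_one] at h2
    linarith
  -- Following `h` by the disc automorphism that sends `h 0` to `0` reduces the claim to the Schwarz
  -- lemma.
  set φ : ℂ → ℂ := fun z => (h z - h 0) / (1 - (starRingEnd ℂ) (h 0) * h z) with hφ
  have hφd : DifferentiableOn ℂ φ (Metric.ball 0 1) :=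
    (hd.sub_const _).div ((hd.const_mul _).const_sub _) fun z hz => norm_pos_iff.1 (hpos z hz)
  have hφm : MapsTo φ (Metric.ball 0 1) (Metric.closedBall 0 1) := by
    intro z hz
    rw [mem_closedBall_zero_iff, hφ, norm_div, div_le_one (hpos z hz)]
    refine (sq_le_sq₀ (norm_nonneg _) (norm_nonneg _)).1 ?_
    have h1 := normSq_one_sub_conj_mul_sub (h 0) (h z)
    have hz1 : ‖h z‖ < 1 := mem_ball_zero_iff.1 (hmaps hz)
    have h2 : 0 ≤ (1 - ‖h 0‖ ^ 2) * (1 - ‖h z‖ ^ 2) :=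
      mul_nonneg (by nlinarith [norm_nonneg (h 0)]) (by nlinarith [norm_nonneg (h z)])
    linarith
  have hφ0 : φ 0 = 0 := by simp [hφ]
  have hle := Complex.dist_le_div_mul_dist_of_mapsTo_ball hφd (by rwa [hφ0]) hw
  rw [hφ0, dist_zero_right, dist_zero_right, div_one, one_mul, hφ, norm_div,
    div_le_iff₀ (hpos w hw)] at hle
  exact hle

/-- Schwarz–Pick in the form of a contraction estimate for `w ↦ w * h w`. -/
lemma norm_sq_mul_one_sub_le {h : ℂ → ℂ} (hd : DifferentiableOn ℂ h (Metric.ball 0 1))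
    (hmaps : MapsTo h (Metric.ball 0 1) (Metric.ball 0 1)) {w : ℂ}
    (hw : w ∈ Metric.ball (0 : ℂ) 1) :
    ‖h w‖ ^ 2 * (1 - ‖w‖ ^ 2) ≤ (1 + ‖h 0‖) / 2 * (1 - ‖w * h w‖ ^ 2) := by
  have hsp := norm_sub_le_of_mapsTo_unitBall hd hmaps hw
  have hid := normSq_one_sub_conj_mul_sub (h 0) (h w)
  have ha1 : ‖h 0‖ < 1 := mem_ball_zero_iff.1 (hmaps zero_mem_unitBall)
  have ht1 : ‖h w‖ < 1 := mem_ball_zero_iff.1 (hmaps hw)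
  have hr1 : ‖w‖ < 1 := mem_ball_zero_iff.1 hw
  have hX : 1 - ‖h 0‖ * ‖h w‖ ≤ ‖1 - (starRingEnd ℂ) (h 0) * h w‖ := by
    have h2 := norm_sub_norm_le (1 : ℂ) ((starRingEnd ℂ) (h 0) * h w)
    rwa [norm_one, norm_mul, RCLike.norm_conj] at h2
  rw [norm_mul]
  set a := ‖h 0‖
  set t := ‖h w‖
  set r := ‖w‖
  set X := ‖1 - (starRingEnd ℂ) (h 0) * h w‖
  have ha0 : 0 ≤ a := norm_nonneg _
  have ht0 : 0 ≤ t := norm_nonneg _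
  have hr0 : 0 ≤ r := norm_nonneg _
  have hat : 0 < 1 - a * t := by nlinarith
  have hr2 : 0 ≤ 1 - r ^ 2 := by nlinarith
  have h1 : (1 - r ^ 2) * (1 - a * t) ^ 2 ≤ (1 - a ^ 2) * (1 - t ^ 2) := by
    have h2 : ‖h w - h 0‖ ^ 2 ≤ r ^ 2 * X ^ 2 := by
      rw [← mul_pow]
      exact pow_le_pow_left₀ (norm_nonneg _) hsp 2
    have h3 : (1 - a * t) ^ 2 ≤ X ^ 2 := pow_le_pow_left₀ hat.le hX 2
    have h4 : (1 - r ^ 2) * (1 - a * t) ^ 2 ≤ (1 - r ^ 2) * X ^ 2 := by gcongr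
    linarith
  -- Uses `t (1 - a) ≤ 1 - a t`. The conclusion then follows from `1 - r² t² = (1 - t²) + t² (1 -
  -- r²)`.
  have h5 : t ^ 2 * (1 - r ^ 2) * (1 - a) ≤ (1 + a) * (1 - t ^ 2) := by
    have h6 : (t * (1 - a)) ^ 2 ≤ (1 - a * t) ^ 2 :=
      pow_le_pow_left₀ (mul_nonneg ht0 (by linarith)) (by linarith) 2
    have h7 : (t ^ 2 * (1 - r ^ 2) * (1 - a)) * (1 - a) ≤ ((1 + a) * (1 - t ^ 2)) * (1 - a) := by
      calc _ = (1 - r ^ 2) * (t * (1 - a)) ^ 2 := by ring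
        _ ≤ (1 - r ^ 2) * (1 - a * t) ^ 2 := by gcongr
        _ ≤ _ := h1
        _ = _ := by ring
    exact le_of_mul_le_mul_right h7 (by linarith)
  rw [mul_pow]
  linarith

/-- The quotient `dslope f 0` of a self-map of the disc that fixes `0` and is not a rotation maps
the disc into itself. -/
lemma mapsTo_dslope_zero {f : ℂ → ℂ} (hd : DifferentiableOn ℂ f (Metric.ball 0 1))
    (hmaps : MapsTo f (Metric.ball 0 1) (Metric.ball 0 1)) (hf0 : f 0 = 0)
    (hrot : ¬ IsDiscRotation f) : MapsTo (dslope f 0) (Metric.ball 0 1) (Metric.ball 0 1) := by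
  have hle : ∀ z ∈ Metric.ball (0 : ℂ) 1, ‖dslope f 0 z‖ ≤ 1 := fun z hz => by
    simpa [hf0] using norm_dslope_zero_le hd (fun w hw => (mem_ball_zero_iff.1 (hmaps hw)).le) hz
  intro z hz
  rw [mem_ball_zero_iff]
  -- Modulus one at an interior point would make the quotient constant by the maximum principle,
  -- hence `f` a rotation.
  refine lt_of_le_of_ne (hle z hz) fun heq => hrot ⟨dslope f 0 z, heq, ?_⟩
  have hmax : IsMaxOn (norm ∘ dslope f 0) (Metric.ball 0 1) z := fun w hw => by
    simpa [heq] using hle w hw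
  have hc := Complex.eqOn_of_isPreconnected_of_isMaxOn_norm (convex_ball _ _).isPreconnected
    Metric.isOpen_ball (differentiableOn_dslope_zero hd) hz hmax
  intro w hw
  have := eq_add_mul_dslope_zero f w
  rw [hf0, zero_add, hc hw] at this
  simp only [this, Function.const_apply]
  ring

/-! ### Covariances of the iterates -/

/-- The quotient `f^[j] z / z`, as a product of values of `dslope f 0` along the orbit. -/
noncomputable def iterateQuotient (f : ℂ → ℂ) (j : ℕ) (z : ℂ) : ℂ :=
  ∏ i ∈ Finset.range j, dslope f 0 (f^[i] z)

section Iterates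

variable {f : ℂ → ℂ}

lemma iterate_eq_mul_iterateQuotient (hf0 : f 0 = 0) (j : ℕ) (z : ℂ) :
    f^[j] z = z * iterateQuotient f j z := by
  induction j with
  | zero => simp [iterateQuotient]
  | succ j ih =>
    have h := eq_add_mul_dslope_zero f (f^[j] z)
    rw [hf0, zero_add] at h
    rw [Function.iterate_succ_apply', h, iterateQuotient, Finset.prod_range_succ, ← mul_assoc]
    rw [iterateQuotient] at ih
    rw [← ih]

lemma isBoundedAnalytic_iterate (hf : IsBoundedAnalytic f)
    (hmaps : MapsTo f (Metric.ball 0 1) (Metric.ball 0 1)) (n : ℕ) :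
    IsBoundedAnalytic (f^[n]) :=
  ⟨by
    induction n with
    | zero => exact differentiableOn_id
    | succ n ih =>
      rw [Function.iterate_succ']
      exact hf.differentiableOn.comp ih (hmaps.iterate n),
    1, fun _ hz => (mem_ball_zero_iff.1 (hmaps.iterate n hz)).le⟩

lemma isBoundedAnalytic_iterateQuotient (hf : IsBoundedAnalytic f)
    (hmaps : MapsTo f (Metric.ball 0 1) (Metric.ball 0 1)) (j : ℕ) :
    IsBoundedAnalytic (iterateQuotient f j) := by
  induction j with
  | zero =>
    have h1 : iterateQuotient f 0 = fun _ => 1 := by ext z; simp [iterateQuotient]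
    rw [h1]
    exact ⟨differentiableOn_const _, 1, by simp⟩
  | succ j ih =>
    have := ih.mul (hf.dslope.comp (isBoundedAnalytic_iterate hf hmaps j) (hmaps.iterate j))
    convert this using 1
    ext z
    simp [iterateQuotient, Finset.prod_range_succ]

/-- Schwarz–Pick telescopes along the orbit: each factor of the product trades the defect `1 - |w|²`
for that of `f w`, gaining `(1 + |f'(0)|) / 2`. -/
lemma norm_iterateQuotient_sq_mul_le (hd : DifferentiableOn ℂ f (Metric.ball 0 1))
    (hmaps : MapsTo f (Metric.ball 0 1) (Metric.ball 0 1)) (hf0 : f 0 = 0)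
    (hrot : ¬ IsDiscRotation f) (j : ℕ) {z : ℂ} (hz : z ∈ Metric.ball (0 : ℂ) 1) :
    ‖iterateQuotient f j z‖ ^ 2 * (1 - ‖z‖ ^ 2) ≤
      ((1 + ‖dslope f 0 0‖) / 2) ^ j * (1 - ‖f^[j] z‖ ^ 2) := by
  induction j with
  | zero => simp [iterateQuotient]
  | succ j ih =>
    have hw := hmaps.iterate j hz
    have h1 := norm_sq_mul_one_sub_le (differentiableOn_dslope_zero hd)
      (mapsTo_dslope_zero hd hmaps hf0 hrot) hw
    have h2 := eq_add_mul_dslope_zero f (f^[j] z)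
    rw [hf0, zero_add] at h2
    rw [← h2, ← Function.iterate_succ_apply' f] at h1
    rw [iterateQuotient, Finset.prod_range_succ, norm_mul, mul_pow]
    rw [iterateQuotient] at ih
    calc _ = ‖dslope f 0 (f^[j] z)‖ ^ 2 *
          (‖∏ i ∈ Finset.range j, dslope f 0 (f^[i] z)‖ ^ 2 * (1 - ‖z‖ ^ 2)) := by ring
      _ ≤ ‖dslope f 0 (f^[j] z)‖ ^ 2 *
          (((1 + ‖dslope f 0 0‖) / 2) ^ j * (1 - ‖f^[j] z‖ ^ 2)) := by gcongr
      _ = ((1 + ‖dslope f 0 0‖) / 2) ^ j *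
          (‖dslope f 0 (f^[j] z)‖ ^ 2 * (1 - ‖f^[j] z‖ ^ 2)) := by ring
      _ ≤ ((1 + ‖dslope f 0 0‖) / 2) ^ j *
          ((1 + ‖dslope f 0 0‖) / 2 * (1 - ‖f^[j + 1] z‖ ^ 2)) := by gcongr
      _ = _ := by ring

/-- The covariance of two iterates with respect to harmonic measure. -/
lemma integral_iterate_sub_mul_conj (hf : IsInnerFunction f) (hf0 : f 0 = 0) {k : ℕ} (hk : 1 ≤ k)
    (j : ℕ) {z : ℂ} (hz : z ∈ Metric.ball (0 : ℂ) 1) :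
    ∫ θ, (boundaryValue (f^[j + k]) θ - f^[j + k] z) *
        (starRingEnd ℂ) (boundaryValue (f^[k]) θ - f^[k] z) ∂discHarmonicMeasure z =
      iterateQuotient f j (f^[k] z) * (1 - ‖f^[k] z‖ ^ 2 : ℝ) := by
  have := isProbabilityMeasure_discHarmonicMeasure hz
  have hfb := hf.isBoundedAnalytic
  have hfk := isBoundedAnalytic_iterate hfb hf.mapsTo k
  have hfn := isBoundedAnalytic_iterate hfb hf.mapsTo (j + k)
  have hq := (isBoundedAnalytic_iterateQuotient hfb hf.mapsTo j).comp hfk (hf.mapsTo.iterate k)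
  set q := iterateQuotient f j ∘ f^[k] with hqdef
  have hfac : ∀ w, f^[j + k] w = f^[k] w * q w := fun w => by
    rw [Function.iterate_add_apply, iterate_eq_mul_iterateQuotient hf0 j, hqdef,
      Function.comp_apply]
  -- Unimodularity of `f^[k]` on the circle replaces the only quadratic term by `q`, leaving terms
  -- linear in boundary values or their conjugates, which the Poisson formula evaluates.
  have hb : ∀ᵐ θ ∂discHarmonicMeasure z,
      (boundaryValue (f^[j + k]) θ - f^[j + k] z) *
        (starRingEnd ℂ) (boundaryValue (f^[k]) θ - f^[k] z) =
      (boundaryValue q θ - (starRingEnd ℂ) (f^[k] z) * boundaryValue (f^[j + k]) θ) -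
        (f^[j + k] z * (starRingEnd ℂ) (boundaryValue (f^[k]) θ) -
          f^[j + k] z * (starRingEnd ℂ) (f^[k] z)) := by
    refine (discHarmonicMeasure_absolutelyContinuous z).ae_le ?_
    filter_upwards [hfk.boundaryValue_mul hq, (hf.iterate hf0 hk).ae_norm_boundaryValue]
      with θ h1 h2
    have h3 : boundaryValue (f^[j + k]) θ = boundaryValue (f^[k]) θ * boundaryValue q θ := by
      rw [← h1, show f^[j + k] = fun w => f^[k] w * q w from funext hfac]
    have h4 : boundaryValue (f^[k]) θ * (starRingEnd ℂ) (boundaryValue (f^[k]) θ) = 1 := by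
      rw [Complex.mul_conj, Complex.normSq_eq_norm_sq, h2]; simp
    rw [map_sub]
    linear_combination (starRingEnd ℂ) (boundaryValue (f^[k]) θ) * h3 + boundaryValue q θ * h4
  have hik := hfk.integrable_boundaryValue hz
  have hin := hfn.integrable_boundaryValue hz
  have hiq := hq.integrable_boundaryValue hz
  have hikc : Integrable (fun θ => (starRingEnd ℂ) (boundaryValue (f^[k]) θ))
      (discHarmonicMeasure z) := (LinearIsometryEquiv.integrable_comp_iff Complex.conjLIE).2 hik
  have hi1 : Integrable (fun θ => boundaryValue q θ -
      (starRingEnd ℂ) (f^[k] z) * boundaryValue (f^[j + k]) θ) (discHarmonicMeasure z) :=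
    hiq.sub (hin.const_mul _)
  have hi2 : Integrable (fun θ => f^[j + k] z * (starRingEnd ℂ) (boundaryValue (f^[k]) θ) -
      f^[j + k] z * (starRingEnd ℂ) (f^[k] z)) (discHarmonicMeasure z) :=
    (hikc.const_mul _).sub (integrable_const _)
  rw [integral_congr_ae hb, integral_sub hi1 hi2, integral_sub hiq (hin.const_mul _),
    integral_sub (hikc.const_mul _) (integrable_const _), integral_const_mul, integral_const_mul,
    integral_conj, hq.integral_boundaryValue hz, hfn.integral_boundaryValue hz,
    hfk.integral_boundaryValue hz]
  simp only [integral_const, probReal_univ, one_smul]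
  rw [sub_self, sub_zero, hfac, hqdef, Function.comp_apply, Complex.ofReal_sub, Complex.ofReal_pow,
    Complex.ofReal_one, mul_sub, mul_one, ← Complex.mul_conj']
  ring

/-- The defect at `f^[k] z` is split into two square roots; one is absorbed by the orbit estimate
and becomes the defect at `f^[j + k] z`. -/
lemma norm_covariance_le_of_le (hf : IsInnerFunction f) (hf0 : f 0 = 0) (hrot : ¬ IsDiscRotation f)
    {k : ℕ} (hk : 1 ≤ k) (j : ℕ) {z : ℂ} (hz : z ∈ Metric.ball (0 : ℂ) 1) :
    ‖∫ θ, (boundaryValue (f^[j + k]) θ - f^[j + k] z) *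
        (starRingEnd ℂ) (boundaryValue (f^[k]) θ - f^[k] z) ∂discHarmonicMeasure z‖ ≤
      √((1 + ‖dslope f 0 0‖) / 2) ^ j *
        (√(1 - ‖f^[j + k] z‖ ^ 2) * √(1 - ‖f^[k] z‖ ^ 2)) := by
  have hw := hf.mapsTo.iterate k hz
  have hd : ∀ {w : ℂ}, w ∈ Metric.ball (0 : ℂ) 1 → 0 ≤ 1 - ‖w‖ ^ 2 := fun {w} hw => by
    have := mem_ball_zero_iff.1 hw
    nlinarith [norm_nonneg w]
  rw [integral_iterate_sub_mul_conj hf hf0 hk j hz, norm_mul, Complex.norm_real,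
    Real.norm_of_nonneg (hd hw)]
  have h1 := norm_iterateQuotient_sq_mul_le hf.differentiableOn hf.mapsTo hf0 hrot j hw
  rw [← Function.iterate_add_apply] at h1
  have h2 := Real.sqrt_le_sqrt h1
  rw [Real.sqrt_mul (by positivity), Real.sqrt_sq (norm_nonneg _), Real.sqrt_mul (by positivity),
    show √(((1 + ‖dslope f 0 0‖) / 2) ^ j) = √((1 + ‖dslope f 0 0‖) / 2) ^ j by
      rw [Real.sqrt_eq_iff_mul_self_eq (by positivity) (by positivity), ← mul_pow,
        Real.mul_self_sqrt (by positivity)]] at h2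
  calc _ = (‖iterateQuotient f j (f^[k] z)‖ * √(1 - ‖f^[k] z‖ ^ 2)) * √(1 - ‖f^[k] z‖ ^ 2) := by
        rw [mul_assoc, Real.mul_self_sqrt (hd hw)]
    _ ≤ _ := mul_le_mul_of_nonneg_right h2 (Real.sqrt_nonneg _)
    _ = _ := by ring

lemma norm_covariance_le (hf : IsInnerFunction f) (hf0 : f 0 = 0) (hrot : ¬ IsDiscRotation f)
    {n k : ℕ} (hn : 1 ≤ n) (hk : 1 ≤ k) {z : ℂ} (hz : z ∈ Metric.ball (0 : ℂ) 1) :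
    ‖∫ θ, (boundaryValue (f^[n]) θ - f^[n] z) *
        (starRingEnd ℂ) (boundaryValue (f^[k]) θ - f^[k] z) ∂discHarmonicMeasure z‖ ≤
      √((1 + ‖dslope f 0 0‖) / 2) ^ (n.dist k) *
        (√(1 - ‖f^[n] z‖ ^ 2) * √(1 - ‖f^[k] z‖ ^ 2)) := by
  rcases le_total k n with hkn | hkn
  · have h := norm_covariance_le_of_le hf hf0 hrot hk (n - k) hz
    rw [Nat.sub_add_cancel hkn] at h
    rwa [Nat.dist_eq_sub_of_le_right hkn]
  · have h := norm_covariance_le_of_le hf hf0 hrot hn (k - n) hz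
    rw [Nat.sub_add_cancel hkn] at h
    rw [Nat.dist_eq_sub_of_le hkn, mul_comm √(1 - ‖f^[n] z‖ ^ 2), ← RCLike.norm_conj,
      ← integral_conj]
    simpa only [map_mul, Complex.conj_conj, mul_comm] using h

end Iterates

/-! ### Schur test and conclusion -/

/-- On each side of `n` the distances are distinct, so each side is dominated by a full geometric
series. -/
lemma sum_pow_dist_le {c : ℝ} (h0 : 0 ≤ c) (h1 : c < 1) (s : Finset ℕ) (n : ℕ) :
    ∑ k ∈ s, c ^ (n.dist k) ≤ 2 / (1 - c) := by
  have hg : ∀ (t : Finset ℕ) (e : ℕ → ℕ), Set.InjOn e t → ∑ k ∈ t, c ^ e k ≤ 1 / (1 - c) := by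
    intro t e he
    rw [← Finset.sum_image he, one_div, ← tsum_geometric_of_lt_one h0 h1]
    exact (summable_geometric_of_lt_one h0 h1).sum_le_tsum _ fun _ _ => by positivity
  rw [← Finset.sum_filter_add_sum_filter_not s (· ≤ n)]
  have ha := hg (s.filter (· ≤ n)) n.dist fun a ha b hb hab => by
    simp only [Finset.coe_filter, mem_ofPred_eq] at ha hb
    rw [Nat.dist_eq_sub_of_le_right ha.2, Nat.dist_eq_sub_of_le_right hb.2] at hab
    omega
  have hb := hg (s.filter (¬ · ≤ n)) n.dist fun a ha b hb hab => by
    simp only [Finset.coe_filter, mem_ofPred_eq, not_le] at ha hb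
    rw [Nat.dist_eq_sub_of_le ha.2.le, Nat.dist_eq_sub_of_le hb.2.le] at hab
    omega
  calc _ ≤ 1 / (1 - c) + 1 / (1 - c) := add_le_add ha hb
    _ = _ := by ring

/-- The Schur test for the Toeplitz kernel `c ^ |n - k|`. -/
lemma sum_sum_pow_dist_mul_le {c : ℝ} (h0 : 0 ≤ c) (h1 : c < 1) (s : Finset ℕ) (x : ℕ → ℝ) :
    ∑ n ∈ s, ∑ k ∈ s, c ^ (n.dist k) * (x n * x k) ≤ 2 / (1 - c) * ∑ n ∈ s, x n ^ 2 := by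
  have hle : ∑ n ∈ s, ∑ k ∈ s, c ^ (n.dist k) * (x n * x k) ≤
      ∑ n ∈ s, ∑ k ∈ s, (c ^ (n.dist k) * x n ^ 2 / 2 + c ^ (n.dist k) * x k ^ 2 / 2) := by
    -- Here `x n * x k ≤ (x n ^ 2 + x k ^ 2) / 2`; the two halves agree by symmetry of the distance.
    refine Finset.sum_le_sum fun n _ => Finset.sum_le_sum fun k _ => ?_
    have := mul_nonneg (pow_nonneg h0 (n.dist k)) (sq_nonneg (x n - x k))
    linarith
  have hhalf : ∑ n ∈ s, ∑ k ∈ s, c ^ (n.dist k) * x n ^ 2 / 2 ≤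
      1 / (1 - c) * ∑ n ∈ s, x n ^ 2 := by
    rw [Finset.mul_sum]
    refine Finset.sum_le_sum fun n _ => ?_
    rw [← Finset.sum_div, ← Finset.sum_mul]
    have := mul_le_mul_of_nonneg_right (sum_pow_dist_le h0 h1 s n) (sq_nonneg (x n))
    linarith [show 2 / (1 - c) * x n ^ 2 = 2 * (1 / (1 - c) * x n ^ 2) by ring]
  have hsymm : ∑ n ∈ s, ∑ k ∈ s, c ^ (n.dist k) * x k ^ 2 / 2 =
      ∑ n ∈ s, ∑ k ∈ s, c ^ (n.dist k) * x n ^ 2 / 2 := by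
    rw [Finset.sum_comm]
    simp only [Nat.dist_comm]
  simp only [Finset.sum_add_distrib] at hle
  rw [hsymm] at hle
  refine hle.trans ((add_le_add hhalf hhalf).trans (le_of_eq ?_))
  ring

lemma integral_norm_sum_sq_le {μ : Measure ℝ} {s : Finset ℕ} (a : ℕ → ℂ) {u : ℕ → ℝ → ℂ}
    (hu : ∀ n ∈ s, MemLp (u n) 2 μ) :
    ∫ θ, ‖∑ n ∈ s, a n * u n θ‖ ^ 2 ∂μ ≤ ∑ n ∈ s, ∑ k ∈ s,
      ‖a n‖ * ‖a k‖ * ‖∫ θ, u n θ * (starRingEnd ℂ) (u k θ) ∂μ‖ := by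
  have hint : ∀ n ∈ s, ∀ k ∈ s, Integrable (fun θ => u n θ * (starRingEnd ℂ) (u k θ)) μ := by
    intro n hn k hk
    exact (hu n hn).integrable_mul (hu k hk).star
  have hexp : ∀ θ, ((‖∑ n ∈ s, a n * u n θ‖ ^ 2 : ℝ) : ℂ) = ∑ n ∈ s, ∑ k ∈ s,
      a n * (starRingEnd ℂ) (a k) * (u n θ * (starRingEnd ℂ) (u k θ)) := by
    intro θ
    rw [Complex.ofReal_pow, ← Complex.mul_conj', map_sum, Finset.sum_mul_sum]
    refine Finset.sum_congr rfl fun n _ => Finset.sum_congr rfl fun k _ => ?_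
    rw [map_mul]
    ring
  have heq : ((∫ θ, ‖∑ n ∈ s, a n * u n θ‖ ^ 2 ∂μ : ℝ) : ℂ) = ∑ n ∈ s, ∑ k ∈ s,
      a n * (starRingEnd ℂ) (a k) * ∫ θ, u n θ * (starRingEnd ℂ) (u k θ) ∂μ := by
    rw [← integral_complex_ofReal]
    simp only [hexp]
    rw [integral_finsetSum _ fun n hn => integrable_finsetSum _ fun k hk =>
      (hint n hn k hk).const_mul _]
    refine Finset.sum_congr rfl fun n hn => ?_
    rw [integral_finsetSum _ fun k hk => (hint n hn k hk).const_mul _]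
    simp only [integral_const_mul]
  refine (le_abs_self _).trans ?_
  rw [← Real.norm_eq_abs, ← Complex.norm_real, heq]
  refine (norm_sum_le _ _).trans (Finset.sum_le_sum fun n _ => (norm_sum_le _ _).trans
    (Finset.sum_le_sum fun k _ => ?_))
  rw [norm_mul, norm_mul, RCLike.norm_conj]

theorem theorem1p2 (f : ℂ → ℂ) (hf : IsInnerFunction f) (hf0 : f 0 = 0)
    (hrot : ¬ IsDiscRotation f) :
    (∀ n : ℕ, 1 ≤ n → IsInnerFunction (f^[n])) ∧
    ∃ C : ℝ, 0 < C ∧ ∀ N : ℕ, 1 ≤ N → ∀ a : ℕ → ℂ, ∀ z ∈ Metric.ball (0 : ℂ) 1,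
      CircleIntegrable (oscillationIntegrand f N a z) 0 1 ∧
      Real.circleAverage (oscillationIntegrand f N a z) 0 1 ≤
        C * ∑ n ∈ Finset.Icc 1 N, ‖a n‖ ^ 2 * (1 - ‖f^[n] z‖ ^ 2) := by
  refine ⟨fun n hn => hf.iterate hf0 hn, ?_⟩
  set c := √((1 + ‖dslope f 0 0‖) / 2) with hc
  have hc0 : 0 ≤ c := Real.sqrt_nonneg _
  -- Here `dslope f 0 0` is `f'(0)`, of modulus less than one because `f` is not a rotation.
  have hc1 : c < 1 := by
    have := mem_ball_zero_iff.1 (mapsTo_dslope_zero hf.differentiableOn hf.mapsTo hf0 hrot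
      zero_mem_unitBall)
    rw [hc, Real.sqrt_lt' one_pos]
    linarith
  refine ⟨2 / (1 - c), div_pos two_pos (by linarith), fun N _ a z hz => ?_⟩
  have := isProbabilityMeasure_discHarmonicMeasure hz
  have hLp : ∀ n ∈ Finset.Icc 1 N, MemLp (fun θ => boundaryValue (f^[n]) θ - f^[n] z) 2
      (discHarmonicMeasure z) := fun n _ =>
    ((isBoundedAnalytic_iterate hf.isBoundedAnalytic hf.mapsTo n).memLp_boundaryValue hz 2).sub
      (memLp_const _)
  have hosc : oscillationIntegrand f N a z = fun ξ => poissonKernel 0 z ξ •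
      ‖∑ n ∈ Finset.Icc 1 N, a n * (radialLimit (f^[n]) ξ - f^[n] z)‖ ^ 2 := by
    ext ξ
    rw [oscillationIntegrand, smul_eq_mul, mul_comm]
  rw [hosc]
  constructor
  · refine (integrable_discHarmonicMeasure_iff hz fun θ => ‖∑ n ∈ Finset.Icc 1 N,
      a n * (boundaryValue (f^[n]) θ - f^[n] z)‖ ^ 2).1 ?_
    exact (memLp_finsetSum _ fun n hn => (hLp n hn).const_mul (a n)).integrable_norm_pow
      two_ne_zero
  · rw [← integral_discHarmonicMeasure_eq_circleAverage hz]
    refine (integral_norm_sum_sq_le a hLp).trans ?_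
    have hschur := sum_sum_pow_dist_mul_le hc0 hc1 (Finset.Icc 1 N)
      fun n => ‖a n‖ * √(1 - ‖f^[n] z‖ ^ 2)
    refine le_trans (Finset.sum_le_sum fun n hn => Finset.sum_le_sum fun k hk => ?_)
      (hschur.trans (le_of_eq ?_))
    · calc _ ≤ ‖a n‖ * ‖a k‖ * (c ^ (n.dist k) *
            (√(1 - ‖f^[n] z‖ ^ 2) * √(1 - ‖f^[k] z‖ ^ 2))) := by
            gcongr
            exact norm_covariance_le hf hf0 hrot (Finset.mem_Icc.1 hn).1 (Finset.mem_Icc.1 hk).1 hz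
        _ = _ := by ring
    · congr 1
      refine Finset.sum_congr rfl fun n _ => ?_
      have := mem_ball_zero_iff.1 (hf.mapsTo.iterate n hz)
      rw [mul_pow, Real.sq_sqrt (by nlinarith [norm_nonneg (f^[n] z)])]
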